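/- **Setting.** Let $\beta,\tau>0$, $d\ge 2$. All operators act on $\mathbb C^d$; $\|\cdot\|_\infty$ is the spectral norm and $\mathcal D[L]\varrho=L\varrho L^\dagger-\tfrac12\{L^\dagger L,\varrho\}$. On $[0,\tau]$ let $H_t$ (self-adjoint) and $L_k(t)$ (finitely many) be bounded measurable operator-valued functions, and let $\{|n_t\rangle\}$ be a measurable orthonormal eigenbasis, $H_t|n_t\rangle=\epsilon_n(t)|n_t\rangle$. Assume $[L_k(t),H_t]=\omega_k(t)L_k(t)$ with $\omega_k(t)\in\mathbb R$, and detailed balance $L_k(t)=e^{\beta\omega_k(t)/2}L_{k'}(t)^\dagger$, where $k\mapsto k'$ is an involution of the index set. Let $\varrho_t$ be a path of density matrices, continuous on $[0,\tau]$, with $$\dot\varrho_t=-i[H_t,\varrho_t]+\sum_k\mathcal D[L_k(t)]\varrho_t$$ for all $t\in(0,\tau)$ outside a countable set. Let $U_t$ be the propagator, $\dot U_t=-iH_tU_t$ (in the same sense), $U_0=\mathbb I$, and write $\tilde A_t=U_t^\dagger A_tU_t$, $|\tilde n_t\rangle=U_t^\dagger|n_t\rangle$. Put $$Q=-\int_0^\tau\mathrm{Tr}(H_t\dot\varrho_t)\,dt,\qquad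 \Delta S=S(\varrho_0)-S(\varrho_\tau),\quad S(\varrho)=-\mathrm{Tr}(\varrho\ln\varrho),$$ $$c_{mn}(t)=\langle m_t|\varrho_t|n_t\rangle,\qquad \mathscr C_\tau=\int_0^\tau\sum_{m\ne n}|c_{mn}(t)|\,dt,\qquad \gamma_t=\sum_k\|L_k(t)\|_\infty^2 .$$ Let $f(x)=x^*/|x|$ for $x\ne0$ and $f(0)=1$. For an operator-valued function $\tilde X_t$ define $\overline\gamma^{\rm R}_\tau\in[0,\infty]$ by $$(\overline\gamma^{\rm R}_\tau)^{-1}=\tau^{-1}\int_0^\tau\sum_k\|[\tilde L_k(t),\tilde X_t]\|_\infty^2\,dt\in[0,\infty].$$ **(a) Qubit.** Let $d=2$, $L_1(t)=\sqrt{\gamma_1(t)}\,|0_t\rangle\langle1_t|$, $L_2(t)=\sqrt{\gamma_2(t)}\,|1_t\rangle\langle0_t|$ be the only jump operators, with $\gamma_1(t),\gamma_2(t)>0$ on $[0,\tau]$, and let $$\tilde X_t=(\gamma_1(t)+\gamma_2(t))^{-1}\left\{f[c_{01}(t)]^*|\tilde0_t\rangle\langle\tilde1_t|+f[c_{10}(t)]^*|\tilde1_t\rangle\langle\tilde0_t|\right\}.$$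 Then $\tilde X_t$ is self-adjoint, $\overline\gamma^{\rm R}_\tau<\infty$, $$(\overline\gamma^{\rm R}_\tau)^{-1}=\tau^{-1}\int_0^\tau\gamma_t^{-1}dt=\tau^{-1}\int_0^\tau(\gamma_1(t)+\gamma_2(t))^{-1}dt,\qquad \beta Q\ \ge\ \Delta S+\frac{\overline\gamma^{\rm R}_\tau\,\mathscr C_\tau^2}{2\tau}.$$ **(b) Generic non-degenerate case.** Let $d\ge2$. Assume that, for every $t\in[0,\tau]$: the levels $\epsilon_n(t)$ are pairwise distinct; each $L_k(t)$ has the form $\sum_{(m,n)\in S}|n_t\rangle\langle n_t|L_k(t)|m_t\rangle\langle m_t|$, where $S$ is a set of ordered pairs $(m,n)$, $m\ne n$, with a common value of $\epsilon_m(t)-\epsilon_n(t)$; and every eigenstate $|n_t\rangle$ can be reached from every other one $|m_t\rangle$ by a finite chain of jumps with nonzero amplitudes $\langle b_t|L_k(t)|a_t\rangle$. Partition the ordered pairs $(m,n)$, $m\neq n$, into the classes $S_1,\dots,S_N$ (depending on $t$) of equal energy change $\epsilon_m(t)-\epsilon_n(t)$. For $(m,m'),(p,q)$ in the same class $S_i$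 let $$\gamma_{mm'}^{pq}(t)=-2\sum_k\langle p_t|L_k(t)|m_t\rangle\langle m'_t|L_k(t)^\dagger|q_t\rangle\quad\text{if }(m,m')\ne(p,q),$$ $$\gamma_{pq}^{pq}(t)=\sum_k\sum_n\left(|\langle n_t|L_k(t)|p_t\rangle|^2+|\langle n_t|L_k(t)|q_t\rangle|^2\right).$$ Then each matrix $[\gamma_{mm'}^{pq}(t)]_{S_i}$ (rows $(m,m')\in S_i$, columns $(p,q)\in S_i$) is invertible. Let $z_{pq}(t)$ be the solution of $$\sum_{(p,q)\in S_i}z_{pq}(t)\,\gamma_{mm'}^{pq}(t)=f[c_{mm'}(t)]\qquad\forall (m,m')\in S_i,\ \forall i,$$ and let $\tilde X_t=\sum_{p\ne q}z_{pq}(t)^*|\tilde p_t\rangle\langle\tilde q_t|$. Then $\tilde X_t$ is self-adjoint, $\overline\gamma^{\rm R}_\tau<\infty$, $$\beta Q\ \ge\ \Delta S+\frac{\overline\gamma^{\rm R}_\tau\,\mathscr C_\tau^2}{2\tau}\qquad\text{and}\qquad \overline\gamma^{\rm R}_\tau\ \ge\ \frac{\tau}{4d(d-1)\displaystyle\int_0^\tau\gamma_t\,\max_i\big\|[\gamma_{mm'}^{pq}(t)]_{S_i}^{-1}\big\|_\infty^2\,dt}.$$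 -/

import Mathlib

open MeasureTheory Set
open scoped Matrix ENNReal Matrix.Norms.L2Operator ComplexOrder

/-! Finite-dimensional open quantum systems with thermal jump operators.
Operators on the `d`-dimensional Hilbert space are complex `d × d` matrices, and `‖A‖` is the
spectral norm (the operator norm for the Euclidean norm). -/

noncomputable section

namespace Landauer

/-- Operators on `ℂ^d`. -/
abbrev Op (d : ℕ) : Type := Matrix (Fin d) (Fin d) ℂ

/-- The commutator `[A, B] = AB - BA`. -/
def opComm {d : ℕ} (A B : Op d) : Op d := A * B - B * A

/-- Density matrices: positive semidefinite of trace one. -/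
def IsDensity {d : ℕ} (ρ : Op d) : Prop := ρ.PosSemidef ∧ ρ.trace = 1

/-- The von Neumann entropy `S(ρ) = - Tr (ρ ln ρ)`, with the convention `0 ln 0 = 0`. -/
def entropy {d : ℕ} (ρ : Op d) : ℝ := -((ρ * cfc Real.log ρ).trace).re

/-- The dissipator `D[L]ρ = L ρ L† - (1/2) {L† L, ρ}`. -/
def dissipator {d : ℕ} (L ρ : Op d) : Op d :=
  L * ρ * Lᴴ - (1 / 2 : ℂ) • (Lᴴ * L * ρ + ρ * (Lᴴ * L))

/-- The Lindblad generator `-i[H, ρ] + ∑ₖ D[Lₖ]ρ`. -/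
def lindblad {d : ℕ} {ι : Type*} [Fintype ι] (H : Op d) (L : ι → Op d) (ρ : Op d) : Op d :=
  -Complex.I • opComm H ρ + ∑ k, dissipator (L k) ρ

/-- A thermal protocol on `[0, τ]`: bounded measurable Hamiltonian `H t` and jump operators `L k t`,
a measurable energy eigenbasis given by the columns of the unitary matrix `V t`, with real energy
levels `ε t n`, energy changes `ω k t` of the jumps, and the detailed balance
`Lₖ = e^{βωₖ/2} Lₖ'†` at inverse temperature `β` between `Lₖ` and its reversed jump `k' = rev k`. -/
structure IsThermalProtocol {d : ℕ} {ι : Type*} [Fintype ι] (β τ : ℝ) (H : ℝ → Op d)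
    (V : ℝ → Op d) (ε : ℝ → Fin d → ℝ) (L : ι → ℝ → Op d) (ω : ι → ℝ → ℝ) (rev : ι → ι) :
    Prop where
  meas_H : AEStronglyMeasurable H (volume.restrict (Icc 0 τ))
  meas_V : AEStronglyMeasurable V (volume.restrict (Icc 0 τ))
  meas_L : ∀ k, AEStronglyMeasurable (L k) (volume.restrict (Icc 0 τ))
  bounded : ∃ B : ℝ, ∀ t ∈ Icc 0 τ, ‖H t‖ ≤ B ∧ ∀ k, ‖L k t‖ ≤ B
  unitary : ∀ t ∈ Icc 0 τ, V t ∈ Matrix.unitaryGroup (Fin d) ℂ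
  eigenbasis : ∀ t ∈ Icc 0 τ, H t * V t = V t * Matrix.diagonal fun n => (ε t n : ℂ)
  energy_change : ∀ k, ∀ t ∈ Icc 0 τ, opComm (L k t) (H t) = (ω k t : ℂ) • L k t
  rev_rev : Function.Involutive rev
  detailed_balance : ∀ k, ∀ t ∈ Icc 0 τ,
    L k t = (Real.exp (β * ω k t / 2) : ℂ) • (L (rev k) t)ᴴ

/-- `ρ` is a path of density matrices, continuous on `[0, τ]`, that solves the Lindblad master
equation on `(0, τ)`; countably many exceptional times (jumps of the control) are allowed. -/
structure IsLindbladPath {d : ℕ} {ι : Type*} [Fintype ι] (τ : ℝ) (H : ℝ → Op d)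
    (L : ι → ℝ → Op d) (ρ : ℝ → Op d) : Prop where
  density : ∀ t ∈ Icc 0 τ, IsDensity (ρ t)
  cont : ContinuousOn ρ (Icc 0 τ)
  master : ∃ s : Set ℝ, s.Countable ∧ ∀ t ∈ Ioo 0 τ \ s,
    HasDerivAt ρ (lindblad (H t) (fun k => L k t) (ρ t)) t

/-- `U` is the unitary propagator (time-ordered exponential of `-i ∫ H`): the solution of
`U̇ = -i H U`, `U 0 = 1` on `[0, τ]`, with the same convention on exceptional times. -/
structure IsPropagator {d : ℕ} (τ : ℝ) (H : ℝ → Op d) (U : ℝ → Op d) : Prop where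
  init : U 0 = 1
  cont : ContinuousOn U (Icc 0 τ)
  schrodinger : ∃ s : Set ℝ, s.Countable ∧ ∀ t ∈ Ioo 0 τ \ s,
    HasDerivAt U (-Complex.I • (H t * U t)) t

/-- The dissipated heat `Q = - ∫₀^τ Tr (H_t ρ̇_t) dt`. -/
def heat {d : ℕ} (τ : ℝ) (H ρ : ℝ → Op d) : ℝ :=
  -∫ t in (0 : ℝ)..τ, ((H t * deriv ρ t).trace).re

/-- The entropy decrease `ΔS = S(ρ_0) - S(ρ_τ)` of the system. -/
def entropyDrop {d : ℕ} (τ : ℝ) (ρ : ℝ → Op d) : ℝ := entropy (ρ 0) - entropy (ρ τ)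

/-- The matrix of `A` in the orthonormal basis of columns of `V`: entry `(m, n)` is `⟨m|A|n⟩`. -/
def rep {d : ℕ} (V A : Op d) : Op d := Vᴴ * A * V

/-- The operator `∑ₘₙ Mₘₙ |m⟩⟨n|` for the orthonormal basis of columns of `W`. -/
def ofRep {d : ℕ} (W M : Op d) : Op d := W * M * Wᴴ

/-- The `ℓ₁`-norm of coherence `∑_{m ≠ n} |⟨m|ρ|n⟩|` in the basis of columns of `V`. -/
def coherenceL1 {d : ℕ} (V ρ : Op d) : ℝ := ∑ m, ∑ n, if m = n then 0 else ‖rep V ρ m n‖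

/-- The time-integrated coherence `𝒞_τ` in the instantaneous energy eigenbasis. -/
def coherence {d : ℕ} (τ : ℝ) (V ρ : ℝ → Op d) : ℝ := ∫ t in (0 : ℝ)..τ, coherenceL1 (V t) (ρ t)

/-- The interaction picture `U† A U`. -/
def interaction {d : ℕ} (U A : Op d) : Op d := Uᴴ * A * U

/-- `γ_t = ∑ₖ ‖Lₖ‖²`. -/
def totalRate {d : ℕ} {ι : Type*} [Fintype ι] (L : ι → Op d) : ℝ := ∑ k, ‖L k‖ ^ 2

/-- `γ̄^R_τ`, given by `(γ̄^R_τ)⁻¹ = τ⁻¹ ∫₀^τ ∑ₖ ‖[L̃ₖ(t), X̃ₜ]‖² dt`, where `L̃ₖ` is `Lₖ` in the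
interaction picture. It takes values in `[0, ∞]`: it is `0` when the integral diverges. -/
def gammaR {d : ℕ} {ι : Type*} [Fintype ι] (τ : ℝ) (L : ι → ℝ → Op d) (U X : ℝ → Op d) : ℝ≥0∞ :=
  ((ENNReal.ofReal τ)⁻¹ * ∫⁻ t in Icc 0 τ,
    ENNReal.ofReal (∑ k, ‖opComm (interaction (U t) (L k t)) (X t)‖ ^ 2))⁻¹

/-- The phase function: `f(x) = x^* / |x|` for `x ≠ 0`, and `f(0) = 1`. -/
def phase (x : ℂ) : ℂ := if x = 0 then 1 else star x / (‖x‖ : ℂ)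

/-! The qubit. -/

/-- The matrix unit `|m⟩⟨n|` for the basis of columns of `V`. -/
def dyad {d : ℕ} (V : Op d) (m n : Fin d) : Op d := ofRep V (Matrix.single m n 1)

/-- `X̃ = γ⁻¹ (f(c₀₁)^* |0̃⟩⟨1̃| + f(c₁₀)^* |1̃⟩⟨0̃|)`, where `γ = γ₁ + γ₂`,
`cₘₙ = ⟨m|ρ|n⟩` and `|ñ⟩ = U†|n⟩`. -/
def qubitX (γ₁ γ₂ : ℝ) (V U ρ : Op 2) : Op 2 :=
  ((γ₁ + γ₂ : ℝ) : ℂ)⁻¹ • (star (phase (rep V ρ 0 1)) • dyad (Uᴴ * V) 0 1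
    + star (phase (rep V ρ 1 0)) • dyad (Uᴴ * V) 1 0)

/-! The generic non-degenerate case. -/

/-- The class `S_g` of the ordered pairs `(m, n)`, `m ≠ n`, with energy change
`ε_m - ε_n = g`. The sets `S_i` are the nonempty ones among these. -/
abbrev GapClass {d : ℕ} (ε : Fin d → ℝ) (g : ℝ) : Type :=
  {p : Fin d × Fin d // p.1 ≠ p.2 ∧ ε p.1 - ε p.2 = g}

/-- `L = ∑_{(m,n) ∈ S_g} |n⟩⟨n|L|m⟩⟨m|` for some `g`: the operator only makes transitions `m → n`
between distinct energy eigenstates, all with the same energy change. -/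
def IsJump {d : ℕ} (V : Op d) (ε : Fin d → ℝ) (L : Op d) : Prop :=
  ∃ g : ℝ, ∀ m n, rep V L n m ≠ 0 → m ≠ n ∧ ε m - ε n = g

/-- Every energy eigenstate can be reached from every other one by finitely many jumps. -/
def IsIrreducible {d : ℕ} {ι : Type*} (V : Op d) (L : ι → Op d) : Prop :=
  ∀ m n, Relation.ReflTransGen (fun a b => ∃ k, rep V (L k) b a ≠ 0) m n

/-- The coefficient `γ_{mm'}^{pq}` with `r = (m, m')` and `c = (p, q)`: it is
`-2 ∑ₖ ⟨p|Lₖ|m⟩⟨m'|Lₖ†|q⟩` for `(m, m') ≠ (p, q)`, and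
`γ_{pq}^{pq} = ∑ₖ ∑ₙ (|⟨n|Lₖ|p⟩|² + |⟨n|Lₖ|q⟩|²)`. -/
def gammaCoeff {d : ℕ} {ι : Type*} [Fintype ι] (V : Op d) (L : ι → Op d)
    (r c : Fin d × Fin d) : ℂ :=
  if r = c then
    ((∑ k, ∑ n, (‖rep V (L k) n c.1‖ ^ 2 + ‖rep V (L k) n c.2‖ ^ 2) : ℝ) : ℂ)
  else -2 * ∑ k, rep V (L k) c.1 r.1 * rep V (L k)ᴴ r.2 c.2

/-- The matrix `[γ_{mm'}^{pq}]_{S_g}`, with row index `(m, m')` and column index `(p, q)`. -/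
def gammaBlock {d : ℕ} {ι : Type*} [Fintype ι] (V : Op d) (ε : Fin d → ℝ) (L : ι → Op d) (g : ℝ) :
    Matrix (GapClass ε g) (GapClass ε g) ℂ :=
  Matrix.of fun r c => gammaCoeff V L r.1 c.1

/-- `z_{pq}` for `p ≠ q`: the solution of
`∑_{(p,q) ∈ S} z_{pq} γ_{mm'}^{pq} = f(c_{mm'})` for all `(m, m') ∈ S`, where `S` is the class of
`(p, q)` and `c_{mm'} = ⟨m|ρ|m'⟩`. -/
def zCoeff {d : ℕ} {ι : Type*} [Fintype ι] (V : Op d) (ε : Fin d → ℝ) (L : ι → Op d) (ρ : Op d)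
    (p q : Fin d) : ℂ :=
  if h : p ≠ q then
    ((gammaBlock V ε L (ε p - ε q))⁻¹ *ᵥ fun r => phase (rep V ρ r.1.1 r.1.2)) ⟨(p, q), h, rfl⟩
  else 0

/-- `X̃ = ∑_{p ≠ q} z_{pq}^* |p̃⟩⟨q̃|`, where `|ñ⟩ = U†|n⟩`. -/
def genericX {d : ℕ} {ι : Type*} [Fintype ι] (V : Op d) (ε : Fin d → ℝ) (L : ι → Op d)
    (U ρ : Op d) : Op d :=
  ofRep (Uᴴ * V) (Matrix.of fun p q => star (zCoeff V ε L ρ p q))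

/-- `max_i ‖[γ_{mm'}^{pq}]_{S_i}⁻¹‖²`; the maximum over the classes is taken by letting each class
be represented by its pairs. -/
def maxInvNormSq {d : ℕ} {ι : Type*} [Fintype ι] (V : Op d) (ε : Fin d → ℝ) (L : ι → Op d) : ℝ :=
  ⨆ i : {p : Fin d × Fin d // p.1 ≠ p.2}, ‖(gammaBlock V ε L (ε i.1.1 - ε i.1.2))⁻¹‖ ^ 2

end Landauer

end

noncomputable section

namespace Landauer

section

variable {d : ℕ} {ι : Type*} [Fintype ι]

/-! Change of orthonormal basis. -/

/-! In the eigenbasis of a positive definite state with eigenvalues p, the entropy production rate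
is a sum over jumps of |L_xy|² p_y (ln p_y − ln p_x + βω). Detailed balance pairs each transition
with its reverse into a term |l|² (p − q)(ln p − ln q). Since the logarithmic mean is at most the
arithmetic mean, completing a square bounds the rate from below by 4s Re Tr(X Dρ) − 2s² Tr(ρ) Σ
‖[L_k, X]‖² for every self-adjoint X and real s, where D is the sum of the dissipators
(`entropy_production_le`).

Suppose −2 Re Tr(X Dρ) is the ℓ₁ coherence at every time. Integration gives 2sC − 2s²G ≤ βQ − ΔS,
with C the integrated coherence and G = ∫ Σ ‖[L_k, X]‖², and s = C/(2G) yields the claim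
(`heat_bound`). Since ρ may be singular, logarithms are taken of ρ + δ; the error is of order δ(2 −
ln δ) and disappears as δ → 0. The entropy is differentiated by means of Klein's inequality, which
avoids differentiating the matrix logarithm.

It remains to find X. The adjoint D† must send X to the operator whose energy-basis entries are −½
f(c_ab)^* off the diagonal and 0 on it. With non-degenerate levels D† acts on matrices of zero
diagonal and preserves the classes of equal gap, so this is the linear system with the coefficients
γ (`sum_gammaCoeff_mul_star`). For M in the kernel, stationarity of the Gibbs weight P gives Σ Tr(P
[L_k, M]†[L_k, M]) = 0, so M commutes with all jumps; it shifts the energy by a nonzero amount,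
hence kills an extremal level, and irreducibility carries this to every level (`isUnit_gammaBlock`).
Uniqueness makes X self-adjoint. The equation for D†X also keeps the commutators away from zero, so
the rate is finite, and a Frobenius estimate of X gives the explicit lower bound. For the qubit
everything is a 2 × 2 computation. -/

theorem rep_mul {V : Op d} (hV : V ∈ Matrix.unitaryGroup (Fin d) ℂ) (A B : Op d) :
    rep V (A * B) = rep V A * rep V B := by
  have h : V * Vᴴ = 1 := Matrix.mem_unitaryGroup_iff.1 hV
  calc rep V (A * B) = Vᴴ * A * 1 * B * V := by simp [rep, mul_assoc]
    _ = rep V A * rep V B := by rw [← h]; simp only [rep, mul_assoc]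

theorem rep_one {V : Op d} (hV : V ∈ Matrix.unitaryGroup (Fin d) ℂ) : rep V 1 = 1 := by
  have h : Vᴴ * V = 1 := Matrix.mem_unitaryGroup_iff'.1 hV
  simp [rep, h]

theorem rep_add (V A B : Op d) : rep V (A + B) = rep V A + rep V B := by
  simp [rep, mul_add, add_mul]

theorem rep_sub (V A B : Op d) : rep V (A - B) = rep V A - rep V B := by
  simp [rep, mul_sub, sub_mul]

theorem rep_smul (V : Op d) (c : ℂ) (A : Op d) : rep V (c • A) = c • rep V A := by
  simp [rep]

theorem rep_neg (V A : Op d) : rep V (-A) = -rep V A := by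
  simp [rep]

theorem rep_sum {κ : Type*} (s : Finset κ) (V : Op d) (A : κ → Op d) :
    rep V (∑ k ∈ s, A k) = ∑ k ∈ s, rep V (A k) := by
  simp [rep, Finset.mul_sum, Finset.sum_mul]

theorem rep_conjTranspose (V A : Op d) : rep V Aᴴ = (rep V A)ᴴ := by
  simp [rep, Matrix.conjTranspose_mul, mul_assoc]

theorem trace_rep {V : Op d} (hV : V ∈ Matrix.unitaryGroup (Fin d) ℂ) (A : Op d) :
    (rep V A).trace = A.trace := by
  have h : V * Vᴴ = 1 := Matrix.mem_unitaryGroup_iff.1 hV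
  rw [rep, Matrix.trace_mul_comm, ← mul_assoc, h, one_mul]

theorem rep_ofRep {V : Op d} (hV : V ∈ Matrix.unitaryGroup (Fin d) ℂ) (M : Op d) :
    rep V (ofRep V M) = M := by
  have h : Vᴴ * V = 1 := Matrix.mem_unitaryGroup_iff'.1 hV
  calc rep V (ofRep V M) = (Vᴴ * V) * M * (Vᴴ * V) := by simp only [rep, ofRep, mul_assoc]
    _ = M := by simp [h]

theorem ofRep_rep {V : Op d} (hV : V ∈ Matrix.unitaryGroup (Fin d) ℂ) (A : Op d) :
    ofRep V (rep V A) = A := by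
  have h : V * Vᴴ = 1 := Matrix.mem_unitaryGroup_iff.1 hV
  calc ofRep V (rep V A) = (V * Vᴴ) * A * (V * Vᴴ) := by simp only [rep, ofRep, mul_assoc]
    _ = A := by simp [h]

theorem norm_rep {V : Op d} (hV : V ∈ Matrix.unitaryGroup (Fin d) ℂ) (A : Op d) :
    ‖rep V A‖ = ‖A‖ := by
  have hV' : star V ∈ unitary (Op d) := Unitary.star_mem hV
  rw [rep, CStarRing.norm_mul_mem_unitary _ hV]
  exact CStarRing.norm_mem_unitary_mul A hV'

theorem rep_opComm {V : Op d} (hV : V ∈ Matrix.unitaryGroup (Fin d) ℂ) (A B : Op d) :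
    rep V (opComm A B) = opComm (rep V A) (rep V B) := by
  simp [opComm, rep_sub, rep_mul hV]

theorem rep_dissipator {V : Op d} (hV : V ∈ Matrix.unitaryGroup (Fin d) ℂ) (L ρ : Op d) :
    rep V (dissipator L ρ) = dissipator (rep V L) (rep V ρ) := by
  simp [dissipator, rep_sub, rep_mul hV, rep_smul, rep_add, rep_conjTranspose]

theorem rep_isHermitian (V : Op d) {A : Op d} (hA : A.IsHermitian) : (rep V A).IsHermitian := by
  rw [Matrix.IsHermitian, ← rep_conjTranspose, hA.eq]

/-! The entropy production inequality for a positive definite state. -/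

/-- The logarithmic mean is at most the arithmetic mean; for a ≥ b this is ln(1 + x) ≥ 2x/(x + 2) at
x = a/b − 1. -/
theorem two_mul_sq_sub_le_mul_log_sub {a b : ℝ} (ha : 0 < a) (hb : 0 < b) :
    2 * (a - b) ^ 2 ≤ (a - b) * (Real.log a - Real.log b) * (a + b) := by
  wlog h : b ≤ a generalizing a b
  · have := this hb ha (le_of_not_ge h)
    nlinarith
  have h1 : 0 ≤ a / b - 1 := by rw [sub_nonneg, le_div_iff₀ hb]; linarith
  have h2 := Real.le_log_one_add_of_nonneg h1
  have h3 : (1 : ℝ) + (a / b - 1) = a / b := by ring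
  rw [h3, Real.log_div ha.ne' hb.ne'] at h2
  have h4 : 2 * (a / b - 1) / (a / b - 1 + 2) = 2 * (a - b) / (a + b) := by
    have : a / b - 1 + 2 = (a + b) / b := by field_simp; ring
    rw [this]; field_simp
  rw [h4, div_le_iff₀ (by positivity)] at h2
  nlinarith [mul_le_mul_of_nonneg_left h2 (sub_nonneg.2 h)]

/-- After multiplication by p + q and use of the mean inequality, the expression is at least the
perfect square 2(‖l‖|p − q| − |s|‖c‖(p + q))². -/
theorem pair_term_nonneg {p q : ℝ} (hp : 0 < p) (hq : 0 < q) (l c : ℂ) (s : ℝ) :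
    0 ≤ ‖l‖ ^ 2 * (p - q) * (Real.log p - Real.log q) - 4 * s * (star l * c).re * (p - q)
      + 2 * s ^ 2 * ‖c‖ ^ 2 * (p + q) := by
  have h1 := two_mul_sq_sub_le_mul_log_sub hp hq
  have h2 : |(star l * c).re| ≤ ‖l‖ * ‖c‖ := by
    calc |(star l * c).re| ≤ ‖star l * c‖ := Complex.abs_re_le_norm _
      _ = ‖l‖ * ‖c‖ := by simp
  have hpq : 0 < p + q := by positivity
  refine nonneg_of_mul_nonneg_left ?_ hpq
  have h3 : s * (star l * c).re * (p - q) ≤ |s| * (‖l‖ * ‖c‖) * |p - q| := by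
    calc s * (star l * c).re * (p - q) ≤ |s * (star l * c).re * (p - q)| := le_abs_self _
      _ = |s| * |(star l * c).re| * |p - q| := by rw [abs_mul, abs_mul]
      _ ≤ _ := by gcongr
  have h4 : 0 ≤ (‖l‖ * |p - q| - |s| * ‖c‖ * (p + q)) ^ 2 := sq_nonneg _
  have h5 : (‖l‖ * |p - q| - |s| * ‖c‖ * (p + q)) ^ 2 = ‖l‖ ^ 2 * (p - q) ^ 2
      - 2 * (|s| * (‖l‖ * ‖c‖) * |p - q|) * (p + q) + s ^ 2 * ‖c‖ ^ 2 * (p + q) ^ 2 := by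
    rw [← sq_abs (p - q), ← sq_abs s]; ring
  have h6 := mul_le_mul_of_nonneg_left h1 (sq_nonneg ‖l‖)
  have h7 := mul_le_mul_of_nonneg_right h3 hpq.le
  nlinarith

/-- Single terms can be negative. Adding to the term (k, x, y) the term (rev k, y, x) gives exactly
the expression of `pair_term_nonneg`, and the involution makes the total of these pairs twice the
sum. -/
theorem entropy_production_sum {β s : ℝ} {ω : ι → ℝ} {rev : ι → ι} {l : ι → Op d} {p : Fin d → ℝ}
    {X : Op d} (hrev : Function.Involutive rev) (hω : ∀ k, ω (rev k) = -ω k)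
    (hdb : ∀ k, l k = (Real.exp (β * ω k / 2) : ℂ) • (l (rev k))ᴴ) (hp : ∀ x, 0 < p x)
    (hX : X.IsHermitian) :
    0 ≤ ∑ k, ∑ x, ∑ y, (‖l k x y‖ ^ 2 * p y * (Real.log (p y) - Real.log (p x) + β * ω k)
      - 4 * s * (star (l k x y) * opComm X (l k) x y).re * p y
      + 2 * s ^ 2 * ‖opComm X (l k) x y‖ ^ 2 * p y) := by
  set F : ι → Fin d → Fin d → ℝ := fun k x y =>
    ‖l k x y‖ ^ 2 * p y * (Real.log (p y) - Real.log (p x) + β * ω k)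
      - 4 * s * (star (l k x y) * opComm X (l k) x y).re * p y
      + 2 * s ^ 2 * ‖opComm X (l k) x y‖ ^ 2 * p y with hF
  have key : ∀ k x y, 0 ≤ F k x y + F (rev k) y x := by
    intro k x y
    set e : ℝ := Real.exp (-(β * ω k) / 2) with he
    have h1 : l (rev k) = (e : ℂ) • (l k)ᴴ := by
      have := hdb (rev k)
      rw [hrev k, hω k] at this
      rw [this, he]
      congr 3
      ring
    have h2 : opComm X (l (rev k)) = -((e : ℂ) • (opComm X (l k))ᴴ) := by
      rw [h1]
      simp only [opComm, Matrix.conjTranspose_sub, Matrix.conjTranspose_mul, hX.eq,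
        Matrix.mul_smul, Matrix.smul_mul]
      rw [smul_sub]
      abel
    have e1 : l (rev k) y x = (e : ℂ) * star (l k x y) := by rw [h1]; simp
    have e2 : opComm X (l (rev k)) y x = -((e : ℂ) * star (opComm X (l k) x y)) := by
      rw [h2]; simp
    have he0 : 0 < e := Real.exp_pos _
    -- With p = p_y, the partner weight is q = e^{−βω} p_x: detailed balance puts the factor e² =
    -- e^{−βω} on the reverse transition, and ln q absorbs the term βω.
    have hq : 0 < e ^ 2 * p x := by have := hp x; positivity
    have hlog : Real.log (e ^ 2 * p x) = Real.log (p x) - β * ω k := by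
      rw [Real.log_mul (by positivity) (hp x).ne', Real.log_pow, he, Real.log_exp]
      push_cast; ring
    have h := pair_term_nonneg (hp y) hq (l k x y) (opComm X (l k) x y) s
    rw [hlog] at h
    have n1 : ‖l (rev k) y x‖ ^ 2 = e ^ 2 * ‖l k x y‖ ^ 2 := by
      rw [e1, norm_mul, norm_star, Complex.norm_real, Real.norm_eq_abs, mul_pow, sq_abs]
    have n2 : ‖opComm X (l (rev k)) y x‖ ^ 2 = e ^ 2 * ‖opComm X (l k) x y‖ ^ 2 := by
      rw [e2, norm_neg, norm_mul, norm_star, Complex.norm_real, Real.norm_eq_abs, mul_pow, sq_abs]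
    have n3 : (star (l (rev k) y x) * opComm X (l (rev k)) y x).re
        = -(e ^ 2 * (star (l k x y) * opComm X (l k) x y).re) := by
      rw [e1, e2]
      simp [Complex.mul_re]
      ring
    simp only [hF]
    rw [n1, n2, n3, hω]
    linarith
  have hsum : ∑ k, ∑ x, ∑ y, F (rev k) y x = ∑ k, ∑ x, ∑ y, F k x y := by
    rw [← Equiv.sum_comp hrev.toPerm (fun k => ∑ x, ∑ y, F k x y)]
    exact Finset.sum_congr rfl fun k _ => Finset.sum_comm
  have : 0 ≤ ∑ k, ∑ x, ∑ y, (F k x y + F (rev k) y x) :=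
    Finset.sum_nonneg fun k _ => Finset.sum_nonneg fun x _ => Finset.sum_nonneg fun y _ => key k x y
  simp only [Finset.sum_add_distrib] at this
  linarith

/-- For self-adjoint A and ρ the two halves of the anticommutator have conjugate traces, so under
the real part they merge into one and combine with the jump term to a commutator. -/
theorem re_trace_mul_dissipator {A ρ : Op d} (hA : A.IsHermitian) (hρ : ρ.IsHermitian) (L : Op d) :
    ((A * dissipator L ρ).trace).re = ((Lᴴ * opComm A L * ρ).trace).re := by
  have h1 : (A * (L * ρ * Lᴴ)).trace = (Lᴴ * (A * L) * ρ).trace := by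
    rw [Matrix.trace_mul_comm, Matrix.mul_assoc, Matrix.trace_mul_comm]
    congr 1
    simp only [Matrix.mul_assoc]
  have h2 : (A * (ρ * (Lᴴ * L))).trace = (Lᴴ * (L * A) * ρ).trace := by
    rw [Matrix.trace_mul_comm, Matrix.mul_assoc, Matrix.trace_mul_comm]
    congr 1
    simp only [Matrix.mul_assoc]
  have h3 : (A * (Lᴴ * L * ρ)).trace = star ((Lᴴ * (L * A) * ρ).trace) := by
    rw [← Matrix.trace_conjTranspose]
    simp only [Matrix.conjTranspose_mul, Matrix.conjTranspose_conjTranspose, hA.eq, hρ.eq]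
    rw [Matrix.trace_mul_comm ρ]
    congr 1
    simp only [Matrix.mul_assoc]
  rw [dissipator, mul_sub, Matrix.trace_sub, h1, Matrix.mul_smul, Matrix.trace_smul, mul_add,
    Matrix.trace_add, h3, h2, opComm, mul_sub, sub_mul, Matrix.trace_sub]
  simp
  ring

/-- A column is the image of a unit vector. -/
theorem sum_norm_sq_col_le (C : Op d) (y : Fin d) : ∑ x, ‖C x y‖ ^ 2 ≤ ‖C‖ ^ 2 := by
  have h := C.l2_opNorm_mulVec (EuclideanSpace.single y 1)
  rw [PiLp.norm_single, norm_one, mul_one] at h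
  have h2 := pow_le_pow_left₀ (norm_nonneg _) h 2
  rw [EuclideanSpace.norm_sq_eq] at h2
  simpa using h2

theorem norm_apply_le (A : Op d) (a b : Fin d) : ‖A a b‖ ≤ ‖A‖ := by
  refine le_of_sq_le_sq ?_ (norm_nonneg _)
  exact (Finset.single_le_sum (f := fun x => ‖A x b‖ ^ 2) (fun _ _ => sq_nonneg _)
    (Finset.mem_univ a)).trans (sum_norm_sq_col_le A b)

theorem entropy_production_diagonal {β s : ℝ} {ω : ι → ℝ} {rev : ι → ι} {L : ι → Op d} {H : Op d}
    {p : Fin d → ℝ} {X : Op d} (hrev : Function.Involutive rev) (hω : ∀ k, ω (rev k) = -ω k)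
    (hdb : ∀ k, L k = (Real.exp (β * ω k / 2) : ℂ) • (L (rev k))ᴴ)
    (hH : H.IsHermitian) (hLH : ∀ k, opComm (L k) H = (ω k : ℂ) • L k) (hp : ∀ x, 0 < p x)
    (hX : X.IsHermitian) :
    4 * s * ((X * ∑ k, dissipator (L k) (Matrix.diagonal fun x => (p x : ℂ))).trace).re
      - 2 * s ^ 2 * (∑ x, p x) * ∑ k, ‖opComm (L k) X‖ ^ 2
    ≤ (((-(Matrix.diagonal fun x => (Real.log (p x) : ℂ)) - (β : ℂ) • H) *
        ∑ k, dissipator (L k) (Matrix.diagonal fun x => (p x : ℂ))).trace).re := by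
  set D : Op d := Matrix.diagonal fun x => (p x : ℂ) with hD
  set E : Op d := Matrix.diagonal fun x => (Real.log (p x) : ℂ) with hE
  have hDh : D.IsHermitian := by
    rw [hD, Matrix.isHermitian_diagonal_iff]
    intro i; simp [isSelfAdjoint_iff]
  have hEh : E.IsHermitian := by
    rw [hE, Matrix.isHermitian_diagonal_iff]
    intro i; simp [isSelfAdjoint_iff]
  have hA : (-E - (β : ℂ) • H).IsHermitian := by
    rw [Matrix.IsHermitian, Matrix.conjTranspose_sub, Matrix.conjTranspose_neg, hEh.eq,
      Matrix.conjTranspose_smul, hH.eq]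
    simp
  have h0 := entropy_production_sum (s := s) hrev hω hdb hp hX
  have tr : ∀ B : Op d, ∀ k, (((L k)ᴴ * B * D).trace).re
      = ∑ x, ∑ y, (star (L k x y) * B x y).re * p y := by
    intro B k
    rw [Matrix.trace, Complex.re_sum, Finset.sum_comm]
    refine Finset.sum_congr rfl fun y _ => ?_
    rw [Matrix.diag_apply, hD, Matrix.mul_diagonal, Matrix.mul_apply, Finset.sum_mul,
      Complex.re_sum]
    refine Finset.sum_congr rfl fun x _ => ?_
    rw [Complex.re_mul_ofReal]; rfl
  have t1 : ((X * ∑ k, dissipator (L k) D).trace).re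
      = ∑ k, ∑ x, ∑ y, (star (L k x y) * opComm X (L k) x y).re * p y := by
    rw [Finset.mul_sum, Matrix.trace_sum, Complex.re_sum]
    exact Finset.sum_congr rfl fun k _ => by rw [re_trace_mul_dissipator hX hDh, tr]
  have hcomm : ∀ k x y, opComm (-E - (β : ℂ) • H) (L k) x y
      = ((Real.log (p y) - Real.log (p x) + β * ω k : ℝ) : ℂ) * L k x y := by
    intro k x y
    have : opComm (-E - (β : ℂ) • H) (L k) = L k * E - E * L k + (β : ℂ) • opComm (L k) H := by
      simp only [opComm, sub_mul, mul_sub, neg_mul, mul_neg, Matrix.smul_mul, Matrix.mul_smul,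
        smul_sub]
      abel
    rw [this, hLH]
    simp [hE, Matrix.mul_diagonal, Matrix.diagonal_mul]
    ring
  have t2 : (((-E - (β : ℂ) • H) * ∑ k, dissipator (L k) D).trace).re
      = ∑ k, ∑ x, ∑ y, ‖L k x y‖ ^ 2 * p y * (Real.log (p y) - Real.log (p x) + β * ω k) := by
    rw [Finset.mul_sum, Matrix.trace_sum, Complex.re_sum]
    refine Finset.sum_congr rfl fun k _ => ?_
    rw [re_trace_mul_dissipator hA hDh, tr]
    refine Finset.sum_congr rfl fun x _ => Finset.sum_congr rfl fun y _ => ?_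
    rw [hcomm, mul_left_comm, Complex.re_ofReal_mul]
    have : (star (L k x y) * L k x y).re = ‖L k x y‖ ^ 2 := by
      rw [Complex.star_def, ← Complex.normSq_eq_conj_mul_self, Complex.ofReal_re,
        Complex.normSq_eq_norm_sq]
    rw [this]; ring
  -- For fixed y the sum over x is a squared column norm, so it is bounded by the spectral norm; the
  -- weights p_y then add up to the trace.
  have t3 : ∑ k, ∑ x, ∑ y, ‖opComm X (L k) x y‖ ^ 2 * p y
      ≤ (∑ x, p x) * ∑ k, ‖opComm (L k) X‖ ^ 2 := by
    rw [Finset.mul_sum]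
    refine Finset.sum_le_sum fun k _ => ?_
    rw [Finset.sum_comm, Finset.sum_mul]
    refine Finset.sum_le_sum fun y _ => ?_
    rw [← Finset.sum_mul, mul_comm]
    refine mul_le_mul_of_nonneg_left ?_ (hp y).le
    have : opComm (L k) X = -opComm X (L k) := by simp [opComm]
    rw [this, norm_neg]
    exact sum_norm_sq_col_le _ _
  rw [t1, t2]
  have expand : ∑ k, ∑ x, ∑ y, (‖L k x y‖ ^ 2 * p y * (Real.log (p y) - Real.log (p x) + β * ω k)
      - 4 * s * (star (L k x y) * opComm X (L k) x y).re * p y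
      + 2 * s ^ 2 * ‖opComm X (L k) x y‖ ^ 2 * p y)
      = ∑ k, ∑ x, ∑ y, ‖L k x y‖ ^ 2 * p y * (Real.log (p y) - Real.log (p x) + β * ω k)
      - 4 * s * ∑ k, ∑ x, ∑ y, (star (L k x y) * opComm X (L k) x y).re * p y
      + 2 * s ^ 2 * ∑ k, ∑ x, ∑ y, ‖opComm X (L k) x y‖ ^ 2 * p y := by
    simp only [Finset.sum_add_distrib, Finset.sum_sub_distrib, Finset.mul_sum, mul_assoc]
  rw [expand] at h0
  have := mul_le_mul_of_nonneg_left t3 (by positivity : 0 ≤ 2 * s ^ 2)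
  linarith

end

section

variable {d : ℕ} {ι : Type*} [Fintype ι]

open Filter Topology

/-! ### Functional calculus in an eigenbasis and the basis-free entropy production bound. -/

theorem rep_eigenvectorUnitary_cfc {A : Op d} (hA : A.IsHermitian) (f : ℝ → ℝ) :
    rep (hA.eigenvectorUnitary : Op d) (cfc f A)
      = Matrix.diagonal fun x => (f (hA.eigenvalues x) : ℂ) := by
  rw [hA.cfc_eq, Matrix.IsHermitian.cfc, Unitary.conjStarAlgAut_apply]
  exact rep_ofRep hA.eigenvectorUnitary.2 _

theorem rep_eigenvectorUnitary_self {A : Op d} (hA : A.IsHermitian) :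
    rep (hA.eigenvectorUnitary : Op d) A
      = Matrix.diagonal fun x => (hA.eigenvalues x : ℂ) := by
  have h := rep_eigenvectorUnitary_cfc hA id
  have h2 : cfc (id : ℝ → ℝ) A = A := cfc_id ℝ A hA
  rwa [h2] at h

theorem trace_mul_eq_sum_eigenvalues {A : Op d} (hA : A.IsHermitian) (f : ℝ → ℝ) :
    (A * cfc f A).trace = ∑ x, ((hA.eigenvalues x * f (hA.eigenvalues x) : ℝ) : ℂ) := by
  rw [← trace_rep hA.eigenvectorUnitary.2, rep_mul hA.eigenvectorUnitary.2,
    rep_eigenvectorUnitary_self, rep_eigenvectorUnitary_cfc, Matrix.diagonal_mul_diagonal,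
    Matrix.trace_diagonal]
  simp

theorem entropy_eq_trace_cfc {A : Op d} (hA : A.IsHermitian) :
    entropy A = -(cfc (fun x => x * Real.log x) A).trace.re := by
  rw [entropy, trace_mul_eq_sum_eigenvalues hA, ← trace_rep hA.eigenvectorUnitary.2,
    rep_eigenvectorUnitary_cfc, Matrix.trace_diagonal]

theorem commute_cfc_self {A : Op d} (hA : A.IsHermitian) (f : ℝ → ℝ) :
    A * cfc f A = cfc f A * A := by
  have hV := hA.eigenvectorUnitary.2
  rw [← ofRep_rep hV (A * cfc f A), ← ofRep_rep hV (cfc f A * A), rep_mul hV, rep_mul hV,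
    rep_eigenvectorUnitary_self, rep_eigenvectorUnitary_cfc, Matrix.diagonal_mul_diagonal,
    Matrix.diagonal_mul_diagonal]
  simp [mul_comm]

theorem isHermitian_of_eigenbasis {H V : Op d} {ε : Fin d → ℝ}
    (hV : V ∈ Matrix.unitaryGroup (Fin d) ℂ)
    (h : H * V = V * Matrix.diagonal fun n => (ε n : ℂ)) : H.IsHermitian := by
  have h1 : V * Vᴴ = 1 := Matrix.mem_unitaryGroup_iff.1 hV
  have h2 : H = ofRep V (Matrix.diagonal fun n => (ε n : ℂ)) := by
    rw [ofRep, ← h, mul_assoc, h1, mul_one]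
  rw [h2, Matrix.IsHermitian, ofRep]
  simp only [Matrix.conjTranspose_mul, Matrix.conjTranspose_conjTranspose,
    Matrix.diagonal_conjTranspose, mul_assoc]
  congr 3
  ext n
  simp

theorem trace_mul_lindblad {H A ρ : Op d} (L : ι → Op d)
    (hA : (A * opComm H ρ).trace = 0) :
    (A * lindblad H L ρ).trace = (A * ∑ k, dissipator (L k) ρ).trace := by
  rw [lindblad, mul_add, Matrix.trace_add, Matrix.mul_smul, Matrix.trace_smul, hA]
  simp

theorem trace_self_mul_opComm (H ρ : Op d) : (H * opComm H ρ).trace = 0 := by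
  rw [opComm, mul_sub, Matrix.trace_sub, Matrix.trace_mul_comm H (ρ * H), mul_assoc,
    Matrix.trace_mul_comm ρ, mul_assoc, sub_self]

theorem trace_mul_opComm_of_commute {A H ρ : Op d} (h : ρ * A = A * ρ) :
    (A * opComm H ρ).trace = 0 := by
  rw [opComm, mul_sub, Matrix.trace_sub, ← mul_assoc A ρ H, ← h, mul_assoc ρ A H,
    Matrix.trace_mul_comm ρ, mul_assoc, sub_self]

/-- Everything is rotated to the eigenbasis of ρ. The Hamiltonian part of the generator drops out of
the right side because ln ρ commutes with ρ and Tr(H[H, ρ]) = 0. -/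
theorem entropy_production_le {β s : ℝ} {ω : ι → ℝ} {rev : ι → ι} {L : ι → Op d} {H : Op d}
    {ρ X : Op d} (hrev : Function.Involutive rev)
    (hdb : ∀ k, L k = (Real.exp (β * ω k / 2) : ℂ) • (L (rev k))ᴴ)
    (hH : H.IsHermitian) (hLH : ∀ k, opComm (L k) H = (ω k : ℂ) • L k) (hρ : ρ.PosDef)
    (hX : X.IsHermitian) :
    4 * s * ((X * ∑ k, dissipator (L k) ρ).trace).re
      - 2 * s ^ 2 * ρ.trace.re * ∑ k, ‖opComm (L k) X‖ ^ 2
    ≤ ((-cfc Real.log ρ * lindblad H L ρ).trace).re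
      - β * ((H * lindblad H L ρ).trace).re := by
  classical
  have hρh := hρ.isHermitian
  have hLrev : ∀ k, L k = 0 → L (rev k) = 0 := by
    intro k hk
    rw [hdb (rev k), hrev k, hk]; simp
  have hωrev : ∀ k, L k ≠ 0 → ω (rev k) = -ω k := by
    intro k hk
    have h1 : (L (rev k))ᴴ ≠ 0 := by
      intro h; apply hk; rw [hdb k, h, smul_zero]
    have h2 : opComm ((L (rev k))ᴴ) H = -((ω (rev k) : ℂ) • (L (rev k))ᴴ) := by
      have := congrArg Matrix.conjTranspose (hLH (rev k))
      simp only [opComm, Matrix.conjTranspose_sub, Matrix.conjTranspose_mul, hH.eq,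
        Matrix.conjTranspose_smul, Complex.star_def, Complex.conj_ofReal] at this
      rw [opComm, ← this]; abel
    have h3 := hLH k
    have h4 : opComm (L k) H = (Real.exp (β * ω k / 2) : ℂ) • opComm ((L (rev k))ᴴ) H := by
      conv_lhs => rw [hdb k]
      simp [opComm, smul_sub]
    rw [h4, h2] at h3
    conv_rhs at h3 => rw [hdb k, smul_comm]
    have he : (Real.exp (β * ω k / 2) : ℂ) ≠ 0 := by
      exact_mod_cast (Real.exp_pos _).ne'
    have h5 := smul_right_injective _ he h3
    rw [← neg_smul] at h5
    have h6 := smul_left_injective ℂ h1 h5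
    have h7 : -ω (rev k) = ω k := by exact_mod_cast h6
    linarith
  -- The relation ω(rev k) = −ω(k) follows from detailed balance only when L_k ≠ 0. For a vanishing
  -- jump the frequency is an arbitrary label, so it is reset to 0.
  set ω' : ι → ℝ := fun k => if L k = 0 then 0 else ω k with hω'
  have hω'rev : ∀ k, ω' (rev k) = -ω' k := by
    intro k
    by_cases hk : L k = 0
    · simp [hω', hk, hLrev k hk]
    · have : L (rev k) ≠ 0 := fun h => hk (by have := hLrev _ h; rwa [hrev k] at this)
      simp [hω', hk, this, hωrev k hk]
  have hV := hρh.eigenvectorUnitary.2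
  set W : Op d := hρh.eigenvectorUnitary.1 with hW
  have key := entropy_production_diagonal (β := β) (s := s) (ω := ω') (rev := rev)
    (L := fun k => rep W (L k)) (H := rep W H) (p := hρh.eigenvalues) (X := rep W X) hrev hω'rev
    (by
      intro k
      by_cases hk : L k = 0
      · simp [hk, hLrev k hk, rep]
      · simp only [hω', hk, if_false]
        conv_lhs => rw [hdb k]
        rw [rep_smul, rep_conjTranspose])
    (rep_isHermitian _ hH)
    (by
      intro k
      rw [← rep_opComm hV, hLH]
      by_cases hk : L k = 0
      · simp [hk, rep]
      · simp only [hω', hk, if_false, rep_smul])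
    (fun x => hρ.eigenvalues_pos x) (rep_isHermitian _ hX)
  rw [← rep_eigenvectorUnitary_cfc hρh Real.log] at key
  rw [← rep_eigenvectorUnitary_self hρh] at key
  simp only [← hW, ← rep_dissipator hV, ← rep_sum, ← rep_mul hV, ← rep_opComm hV, norm_rep hV,
    trace_rep hV, ← rep_smul, ← rep_neg, ← rep_sub] at key
  have htr : ρ.trace.re = ∑ x, hρh.eigenvalues x := by
    rw [hρh.trace_eq_sum_eigenvalues, Complex.re_sum]; rfl
  rw [htr]
  refine key.trans (le_of_eq ?_)
  rw [trace_mul_lindblad L (trace_self_mul_opComm H ρ), trace_mul_lindblad L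
    (trace_mul_opComm_of_commute (by rw [mul_neg, neg_mul, commute_cfc_self hρh]))]
  rw [sub_mul, Matrix.trace_sub, Complex.sub_re, Matrix.smul_mul, Matrix.trace_smul, smul_eq_mul,
    Complex.re_ofReal_mul]

/-! Klein's inequality and the derivative of the entropy. -/

/-- The squared moduli of the entries of a unitary matrix form a doubly stochastic matrix. -/
theorem sum_norm_sq_row_unitary {u : Op d} (hu : u ∈ Matrix.unitaryGroup (Fin d) ℂ) (i : Fin d) :
    ∑ j, ‖u i j‖ ^ 2 = 1 := by
  have h : (u * uᴴ) i i = 1 := by rw [← Matrix.star_eq_conjTranspose,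
    Matrix.mem_unitaryGroup_iff.1 hu, Matrix.one_apply_eq]
  rw [Matrix.mul_apply] at h
  have h2 : (((∑ j, ‖u i j‖ ^ 2 : ℝ)) : ℂ) = 1 := by
    rw [← h]
    push_cast
    refine Finset.sum_congr rfl fun j _ => ?_
    rw [Matrix.conjTranspose_apply, Complex.star_def, Complex.mul_conj, Complex.normSq_eq_norm_sq]
    push_cast; rfl
  exact_mod_cast h2

theorem sum_norm_sq_col_unitary {u : Op d} (hu : u ∈ Matrix.unitaryGroup (Fin d) ℂ) (j : Fin d) :
    ∑ i, ‖u i j‖ ^ 2 = 1 := by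
  have h := sum_norm_sq_row_unitary (Unitary.star_mem hu) j
  simpa using h

/-- Inserting both spectral decompositions leaves the transition probabilities |⟨a_i|b_j⟩|², which
reduces trace inequalities to scalar ones. -/
theorem re_trace_mul_cfc {A B : Op d} (hA : A.IsHermitian) (hB : B.IsHermitian) (f : ℝ → ℝ) :
    ((A * cfc f B).trace).re = ∑ i, ∑ j, ‖((hA.eigenvectorUnitary : Op d)ᴴ *
      (hB.eigenvectorUnitary : Op d)) i j‖ ^ 2 * (hA.eigenvalues i * f (hB.eigenvalues j)) := by
  have hV := hA.eigenvectorUnitary.2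
  have hY := hB.eigenvectorUnitary.2
  set V : Op d := hA.eigenvectorUnitary.1
  set Y : Op d := hB.eigenvectorUnitary.1
  have h1 : rep Y A = rep (Vᴴ * Y) (Matrix.diagonal fun x => (hA.eigenvalues x : ℂ)) := by
    rw [← rep_eigenvectorUnitary_self hA]
    conv_lhs => rw [← ofRep_rep hV A]
    simp only [rep, ofRep, Matrix.conjTranspose_mul, Matrix.conjTranspose_conjTranspose, mul_assoc]
    rfl
  rw [← trace_rep hY, rep_mul hY, rep_eigenvectorUnitary_cfc, h1, Matrix.trace, Complex.re_sum,
    Finset.sum_comm]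
  refine Finset.sum_congr rfl fun j _ => ?_
  rw [Matrix.diag_apply, Matrix.mul_diagonal, rep, Matrix.mul_apply, Finset.sum_mul,
    Complex.re_sum]
  refine Finset.sum_congr rfl fun i _ => ?_
  rw [Matrix.mul_diagonal, Matrix.conjTranspose_apply]
  set u := (Vᴴ * Y) i j
  have : star u * (hA.eigenvalues i : ℂ) * u * (f (hB.eigenvalues j) : ℂ)
      = ((‖u‖ ^ 2 * (hA.eigenvalues i * f (hB.eigenvalues j)) : ℝ) : ℂ) := by
    have h3 : star u * u = ((‖u‖ ^ 2 : ℝ) : ℂ) := by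
      rw [Complex.star_def, ← Complex.normSq_eq_conj_mul_self, Complex.normSq_eq_norm_sq]
    calc star u * (hA.eigenvalues i : ℂ) * u * (f (hB.eigenvalues j) : ℂ)
        = (star u * u) * ((hA.eigenvalues i : ℂ) * (f (hB.eigenvalues j) : ℂ)) := by ring
      _ = _ := by rw [h3]; push_cast; rfl
  rw [this, Complex.ofReal_re]

/-- The concave entropy lies below its tangent at B. The scalar inequality a ln(b/a) ≤ b − a is
averaged over the doubly stochastic matrix of overlaps of the two eigenbases. -/
theorem entropy_sub_le {A B : Op d} (hA : A.PosDef) (hB : B.PosDef) :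
    entropy A - entropy B ≤ -(((A - B) * (cfc Real.log B + 1)).trace).re := by
  have hAh := hA.isHermitian
  have hBh := hB.isHermitian
  have hu : (hAh.eigenvectorUnitary : Op d)ᴴ * (hBh.eigenvectorUnitary : Op d)
      ∈ Matrix.unitaryGroup (Fin d) ℂ :=
    mul_mem (Unitary.star_mem hAh.eigenvectorUnitary.2) hBh.eigenvectorUnitary.2
  set u := (hAh.eigenvectorUnitary : Op d)ᴴ * (hBh.eigenvectorUnitary : Op d) with hu_def
  have row : ∀ g : Fin d → ℝ, ∑ i, ∑ j, ‖u i j‖ ^ 2 * g i = ∑ i, g i := fun g =>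
    Finset.sum_congr rfl fun i _ => by
      rw [← Finset.sum_mul, sum_norm_sq_row_unitary hu, one_mul]
  have col : ∀ g : Fin d → ℝ, ∑ i, ∑ j, ‖u i j‖ ^ 2 * g j = ∑ i, g i := fun g => by
    rw [Finset.sum_comm]
    exact Finset.sum_congr rfl fun i _ => by
      rw [← Finset.sum_mul, sum_norm_sq_col_unitary hu, one_mul]
  have tA : A.trace.re = ∑ i, hAh.eigenvalues i := by
    rw [hAh.trace_eq_sum_eigenvalues, Complex.re_sum]; rfl
  have tB : B.trace.re = ∑ i, hBh.eigenvalues i := by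
    rw [hBh.trace_eq_sum_eigenvalues, Complex.re_sum]; rfl
  have lA : ((A * cfc Real.log A).trace).re
      = ∑ i, hAh.eigenvalues i * Real.log (hAh.eigenvalues i) := by
    rw [trace_mul_eq_sum_eigenvalues hAh, Complex.re_sum]
    simp
  have key : ∑ i, ∑ j, ‖u i j‖ ^ 2 * (hAh.eigenvalues i * Real.log (hBh.eigenvalues j))
      ≤ ∑ i, ∑ j, (‖u i j‖ ^ 2 * (hAh.eigenvalues i * Real.log (hAh.eigenvalues i))
        - ‖u i j‖ ^ 2 * hAh.eigenvalues i + ‖u i j‖ ^ 2 * hBh.eigenvalues j) := by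
    refine Finset.sum_le_sum fun i _ => Finset.sum_le_sum fun j _ => ?_
    have ha := hA.eigenvalues_pos i
    have hb := hB.eigenvalues_pos j
    have h1 := Real.log_le_sub_one_of_pos (div_pos hb ha)
    rw [Real.log_div hb.ne' ha.ne'] at h1
    have h2 := mul_le_mul_of_nonneg_left h1 ha.le
    have h3 : hAh.eigenvalues i * (hBh.eigenvalues j / hAh.eigenvalues i - 1)
        = hBh.eigenvalues j - hAh.eigenvalues i := by field_simp
    rw [h3] at h2
    have h4 := mul_le_mul_of_nonneg_left h2 (sq_nonneg ‖u i j‖)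
    linarith
  rw [← re_trace_mul_cfc hAh hBh] at key
  simp only [Finset.sum_add_distrib, Finset.sum_sub_distrib] at key
  rw [row fun i => hAh.eigenvalues i * Real.log (hAh.eigenvalues i), row, col, ← lA, ← tA, ← tB]
    at key
  rw [entropy, entropy]
  simp only [sub_mul, mul_add, mul_one, Matrix.trace_sub, Matrix.trace_add, Complex.sub_re,
    Complex.add_re]
  linarith

/-- The trace as a continuous linear functional with values in `ℝ`. -/
def reTraceCLM (d : ℕ) : Op d →L[ℝ] ℝ :=
  LinearMap.toContinuousLinearMap (Complex.reLm ∘ₗ (Matrix.traceLinearMap (Fin d) ℝ ℂ))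

theorem reTraceCLM_apply (A : Op d) : reTraceCLM d A = A.trace.re := rfl

theorem hasDerivAt_of_le_of_le {f g h : ℝ → ℝ} {f' t : ℝ} (hg : HasDerivAt g f' t)
    (hh : HasDerivAt h f' t) (h1 : ∀ᶠ s in 𝓝 t, f s - f t ≤ g s - g t)
    (h2 : ∀ᶠ s in 𝓝 t, h s - h t ≤ f s - f t) : HasDerivAt f f' t := by
  rw [hasDerivAt_iff_isLittleO] at hg hh ⊢
  refine Asymptotics.IsBigO.trans_isLittleO (Asymptotics.IsBigO.of_bound 1 ?_)
    (hg.norm_left.add hh.norm_left)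
  filter_upwards [h1, h2] with s h1 h2
  simp only [smul_eq_mul, Real.norm_eq_abs, one_mul]
  rw [abs_of_nonneg (a := |_| + |_|) (by positivity), abs_le]
  constructor
  · have a1 := neg_abs_le (h s - h t - (s - t) * f')
    have a2 := abs_nonneg (g s - g t - (s - t) * f')
    linarith
  · have a1 := le_abs_self (g s - g t - (s - t) * f')
    have a2 := abs_nonneg (h s - h t - (s - t) * f')
    linarith

/-- Klein's inequality with base point ρ_t and with base point ρ_s squeezes the increment between
two functions with the same derivative at t. Only continuity of ln ρ is needed, not its derivative.
-/
theorem hasDerivAt_entropy {ρ : ℝ → Op d} {ρ' : Op d} {t : ℝ} (hρ : HasDerivAt ρ ρ' t)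
    (hpos : ∀ᶠ s in 𝓝 t, (ρ s).PosDef) (hcont : ContinuousAt (fun s => cfc Real.log (ρ s)) t) :
    HasDerivAt (fun s => entropy (ρ s)) (-((ρ' * (cfc Real.log (ρ t) + 1)).trace).re) t := by
  have aux : ∀ K : ℝ → Op d, ContinuousAt K t →
      HasDerivAt (fun s => -(((ρ s - ρ t) * K s).trace).re) (-((ρ' * K t).trace).re) t := by
    intro K hK
    rw [hasDerivAt_iff_tendsto_slope]
    have h1 := (hasDerivAt_iff_tendsto_slope.1 hρ).mul (hK.tendsto.mono_left nhdsWithin_le_nhds)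
    have h2 := (((reTraceCLM d).continuous.tendsto _).comp h1).neg
    refine h2.congr fun s => ?_
    simp only [Function.comp, reTraceCLM_apply, slope_def_module, sub_self, zero_mul,
      Matrix.trace_zero, Complex.zero_re, neg_zero, sub_zero]
    rw [Matrix.smul_mul, Matrix.trace_smul, Complex.smul_re, smul_neg]
  refine hasDerivAt_of_le_of_le (aux (fun _ => cfc Real.log (ρ t) + 1) continuousAt_const)
    (aux (fun s => cfc Real.log (ρ s) + 1) (hcont.add continuousAt_const)) ?_ ?_
  · filter_upwards [hpos] with s hs
    have := entropy_sub_le hs hpos.self_of_nhds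
    simpa using this
  · filter_upwards [hpos] with s hs
    have := entropy_sub_le hpos.self_of_nhds hs
    have e : ρ t - ρ s = -(ρ s - ρ t) := by abel
    rw [e, neg_mul, Matrix.trace_neg, Complex.neg_re] at this
    simp only [sub_self, zero_mul, Matrix.trace_zero, Complex.zero_re, neg_zero, sub_zero]
    linarith

/-! Regularized density matrices. -/

theorem isHermitian_real_smul_one (δ : ℝ) : ((δ : ℂ) • (1 : Op d)).IsHermitian := by
  rw [Matrix.IsHermitian, Matrix.conjTranspose_smul, Matrix.conjTranspose_one]
  simp

theorem IsDensity.posDef_add {ρ : Op d} (hρ : IsDensity ρ) {δ : ℝ} (hδ : 0 < δ) :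
    (ρ + (δ : ℂ) • 1).PosDef :=
  Matrix.PosDef.posSemidef_add hρ.1 (Matrix.PosDef.one.smul (by exact_mod_cast hδ))

/-- Nonnegative eigenvalues of sum 1 lie in [0, 1]. A compact interval common to all times is what
continuity of the functional calculus requires. -/
theorem IsDensity.spectrum_add_subset {ρ : Op d} (hρ : IsDensity ρ) (δ : ℝ) :
    spectrum ℝ (ρ + (δ : ℂ) • 1) ⊆ Icc δ (1 + δ) := by
  have h1 : ρ + (δ : ℂ) • 1 = ρ + algebraMap ℝ (Op d) δ := by
    rw [Algebra.algebraMap_eq_smul_one]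
    rfl
  have hh := hρ.1.isHermitian
  rw [h1, ← spectrum.add_singleton_eq, hh.spectrum_real_eq_range_eigenvalues]
  rintro _ ⟨_, ⟨i, rfl⟩, _, rfl, rfl⟩
  have h0 : ∀ j, 0 ≤ hh.eigenvalues j := fun j => hρ.1.eigenvalues_nonneg j
  have hs : ∑ j, hh.eigenvalues j = 1 := by
    have := hh.trace_eq_sum_eigenvalues
    rw [hρ.2] at this
    have h2 := congrArg Complex.re this
    rw [Complex.re_sum] at h2
    simpa using h2.symm
  have := Finset.single_le_sum (fun j _ => h0 j) (Finset.mem_univ i)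
  have h3 := h0 i
  simp only [mem_Icc]
  constructor <;> linarith

theorem continuousOn_cfc_log_add {ρ : ℝ → Op d} {s : Set ℝ} (hρ : ContinuousOn ρ s)
    (hd : ∀ t ∈ s, IsDensity (ρ t)) {δ : ℝ} (hδ : 0 < δ) :
    ContinuousOn (fun t => cfc Real.log (ρ t + (δ : ℂ) • 1)) s :=
  ContinuousOn.cfc' (isCompact_Icc (a := δ) (b := 1 + δ)) Real.log (hρ.add continuousOn_const)
    (fun t ht => (hd t ht).spectrum_add_subset δ)
    (fun t ht => (hd t ht).1.isHermitian.add (isHermitian_real_smul_one δ))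
    (Real.continuousOn_log.mono fun _ hx => (hδ.trans_le hx.1).ne')

/-- Expressed through x ln x, which is continuous on the whole line, the entropy causes no
difficulty at zero eigenvalues, so δ is unrestricted. -/
theorem continuousOn_entropy_add {ρ : ℝ → Op d} {s : Set ℝ} (hρ : ContinuousOn ρ s)
    (hd : ∀ t ∈ s, IsDensity (ρ t)) (δ : ℝ) :
    ContinuousOn (fun t => entropy (ρ t + (δ : ℂ) • 1)) s := by
  have h1 : ContinuousOn (fun t => cfc (fun x => x * Real.log x) (ρ t + (δ : ℂ) • 1)) s :=
    ContinuousOn.cfc' (isCompact_Icc (a := δ) (b := 1 + δ)) _ (hρ.add continuousOn_const)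
      (fun t ht => (hd t ht).spectrum_add_subset δ)
      (fun t ht => (hd t ht).1.isHermitian.add (isHermitian_real_smul_one δ))
      Real.continuous_mul_log.continuousOn
  refine (((reTraceCLM d).continuous.comp_continuousOn h1).neg).congr fun t ht => ?_
  exact entropy_eq_trace_cfc ((hd t ht).1.isHermitian.add (isHermitian_real_smul_one δ))

theorem tendsto_entropy_add {ρ : Op d} (hρ : IsDensity ρ) :
    Tendsto (fun δ : ℝ => entropy (ρ + (δ : ℂ) • 1)) (𝓝[>] 0) (𝓝 (entropy ρ)) := by
  have h1 : ContinuousOn (fun δ : ℝ => cfc (fun x => x * Real.log x) (ρ + (δ : ℂ) • 1))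
      (Icc 0 1) :=
    ContinuousOn.cfc' (isCompact_Icc (a := 0) (b := 2)) _
      (by fun_prop)
      (fun δ hδ => (hρ.spectrum_add_subset δ).trans
        (Icc_subset_Icc hδ.1 (by linarith [hδ.2])))
      (fun δ _ => hρ.1.isHermitian.add (isHermitian_real_smul_one δ))
      Real.continuous_mul_log.continuousOn
  have h2 : ContinuousOn (fun δ : ℝ => entropy (ρ + (δ : ℂ) • 1)) (Icc 0 1) :=
    (((reTraceCLM d).continuous.comp_continuousOn h1).neg).congr fun δ _ =>
      entropy_eq_trace_cfc (hρ.1.isHermitian.add (isHermitian_real_smul_one δ))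
  have h3 := (h2 0 (by simp)).mono_left (nhdsWithin_le_of_mem (Icc_mem_nhdsGT zero_lt_one))
  simpa [ContinuousWithinAt] using h3

theorem norm_cfc_log_add_le {ρ : Op d} (hρ : IsDensity ρ) {δ : ℝ} (hδ : 0 < δ) (hδ1 : δ ≤ 1) :
    ‖cfc Real.log (ρ + (δ : ℂ) • 1)‖ ≤ 1 - Real.log δ := by
  have hl := Real.log_nonpos hδ.le hδ1
  refine norm_cfc_le (by linarith) fun x hx => ?_
  have h := hρ.spectrum_add_subset δ hx
  have hx0 : 0 < x := hδ.trans_le h.1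
  rw [Real.norm_eq_abs, abs_le]
  constructor
  · have := Real.log_le_log hδ h.1
    linarith
  · have := Real.log_le_sub_one_of_pos hx0
    linarith [h.2]

end

section

variable {d : ℕ} {ι : Type*} [Fintype ι]

open Filter Topology

/-! The Lindblad generator: linearity, boundedness and measurability. -/

theorem dissipator_add_smul (L ρ σ : Op d) (c : ℂ) :
    dissipator L (ρ + c • σ) = dissipator L ρ + c • dissipator L σ := by
  simp only [dissipator, mul_add, add_mul, Matrix.mul_smul, Matrix.smul_mul]
  module

theorem opComm_add_smul (A ρ σ : Op d) (c : ℂ) :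
    opComm A (ρ + c • σ) = opComm A ρ + c • opComm A σ := by
  simp only [opComm, mul_add, add_mul, Matrix.mul_smul, Matrix.smul_mul]
  module

theorem lindblad_add_smul (H : Op d) (L : ι → Op d) (ρ σ : Op d) (c : ℂ) :
    lindblad H L (ρ + c • σ) = lindblad H L ρ + c • lindblad H L σ := by
  simp only [lindblad, dissipator_add_smul, opComm_add_smul, Finset.sum_add_distrib,
    ← Finset.smul_sum]
  module

theorem trace_dissipator (L ρ : Op d) : (dissipator L ρ).trace = 0 := by
  rw [dissipator, Matrix.trace_sub, Matrix.trace_smul, Matrix.trace_add,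
    Matrix.trace_mul_comm ρ, Matrix.trace_mul_comm (L * ρ), ← mul_assoc, smul_eq_mul]
  ring

theorem trace_lindblad (H : Op d) (L : ι → Op d) (ρ : Op d) : (lindblad H L ρ).trace = 0 := by
  have h := trace_mul_lindblad (H := H) (A := 1) (ρ := ρ) L
    (trace_mul_opComm_of_commute (by simp))
  simpa [Matrix.trace_sum, trace_dissipator] using h

theorem norm_opComm_le (A B : Op d) : ‖opComm A B‖ ≤ 2 * ‖A‖ * ‖B‖ := by
  calc ‖opComm A B‖ ≤ ‖A * B‖ + ‖B * A‖ := norm_sub_le _ _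
    _ ≤ ‖A‖ * ‖B‖ + ‖B‖ * ‖A‖ := add_le_add (norm_mul_le _ _) (norm_mul_le _ _)
    _ = _ := by ring

theorem norm_dissipator_le (L ρ : Op d) : ‖dissipator L ρ‖ ≤ 2 * ‖L‖ ^ 2 * ‖ρ‖ := by
  have hs : ‖Lᴴ‖ = ‖L‖ := Matrix.l2_opNorm_conjTranspose L
  have h1 : ‖L * ρ * Lᴴ‖ ≤ ‖L‖ ^ 2 * ‖ρ‖ := by
    calc ‖L * ρ * Lᴴ‖ ≤ ‖L‖ * ‖ρ‖ * ‖Lᴴ‖ := (norm_mul_le _ _).trans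
          (mul_le_mul_of_nonneg_right (norm_mul_le _ _) (norm_nonneg _))
      _ = _ := by rw [hs]; ring
  have h2 : ‖Lᴴ * L‖ = ‖L‖ * ‖L‖ := Matrix.l2_opNorm_conjTranspose_mul_self L
  have h3 : ‖Lᴴ * L * ρ‖ ≤ ‖L‖ ^ 2 * ‖ρ‖ := by
    refine (norm_mul_le _ _).trans (le_of_eq ?_); rw [h2]; ring
  have h4 : ‖ρ * (Lᴴ * L)‖ ≤ ‖L‖ ^ 2 * ‖ρ‖ := by
    refine (norm_mul_le _ _).trans (le_of_eq ?_); rw [h2]; ring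
  calc ‖dissipator L ρ‖ ≤ ‖L * ρ * Lᴴ‖ + ‖(1 / 2 : ℂ) • (Lᴴ * L * ρ + ρ * (Lᴴ * L))‖ :=
        norm_sub_le _ _
    _ ≤ ‖L‖ ^ 2 * ‖ρ‖ + 1 / 2 * (‖L‖ ^ 2 * ‖ρ‖ + ‖L‖ ^ 2 * ‖ρ‖) := by
        refine add_le_add h1 ?_
        rw [norm_smul]
        have : ‖(1 / 2 : ℂ)‖ = 1 / 2 := by simp
        rw [this]
        gcongr
        exact (norm_add_le _ _).trans (add_le_add h3 h4)
    _ = _ := by ring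

theorem norm_lindblad_le {B : ℝ} {H : Op d} {L : ι → Op d} (hH : ‖H‖ ≤ B) (hL : ∀ k, ‖L k‖ ≤ B)
    (ρ : Op d) : ‖lindblad H L ρ‖ ≤ (2 * B + Fintype.card ι * (2 * B ^ 2)) * ‖ρ‖ := by
  have h1 : ‖-Complex.I • opComm H ρ‖ ≤ 2 * B * ‖ρ‖ := by
    rw [norm_smul, norm_neg, Complex.norm_I, one_mul]
    refine (norm_opComm_le _ _).trans ?_
    gcongr
  have h2 : ‖∑ k, dissipator (L k) ρ‖ ≤ ∑ _k : ι, 2 * B ^ 2 * ‖ρ‖ :=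
    norm_sum_le_of_le _ fun k _ => (norm_dissipator_le _ _).trans (by have := hL k; gcongr)
  rw [Finset.sum_const, Finset.card_univ, nsmul_eq_mul] at h2
  calc ‖lindblad H L ρ‖ ≤ _ := norm_add_le _ _
    _ ≤ _ := add_le_add h1 h2
    _ = _ := by ring

theorem aestronglyMeasurable_lindblad {μ : Measure ℝ} {H ρ : ℝ → Op d} {L : ι → ℝ → Op d}
    (hH : AEStronglyMeasurable H μ) (hL : ∀ k, AEStronglyMeasurable (L k) μ)
    (hρ : AEStronglyMeasurable ρ μ) :
    AEStronglyMeasurable (fun t => lindblad (H t) (fun k => L k t) (ρ t)) μ := by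
  have hs : ∀ k, AEStronglyMeasurable (fun t => (L k t)ᴴ) μ := fun k =>
    (continuous_star (R := Op d)).comp_aestronglyMeasurable (hL k)
  have h1 : AEStronglyMeasurable (fun t => opComm (H t) (ρ t)) μ :=
    (hH.mul hρ).sub (hρ.mul hH)
  refine AEStronglyMeasurable.add (h1.const_smul (-Complex.I)) ?_
  refine Finset.aestronglyMeasurable_fun_sum _ fun k _ => ?_
  exact (((hL k).mul hρ).mul (hs k)).sub
    (((((hs k).mul (hL k)).mul hρ).add (hρ.mul ((hs k).mul (hL k)))).const_smul (1 / 2 : ℂ))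

/-! The propagator is unitary. -/

/-- U†U is continuous with zero derivative off a countable set, hence constant. -/
theorem IsPropagator.mem_unitaryGroup {τ : ℝ} {H U : ℝ → Op d} (hU : IsPropagator τ H U)
    (hH : ∀ t ∈ Icc 0 τ, (H t).IsHermitian) {t : ℝ} (ht : t ∈ Icc 0 τ) :
    U t ∈ Matrix.unitaryGroup (Fin d) ℂ := by
  obtain ⟨s, hs, hd⟩ := hU.schrodinger
  have hsub : Icc 0 t ⊆ Icc 0 τ := Icc_subset_Icc_right ht.2
  have hc : ContinuousOn (fun r => star (U r) * U r) (Icc 0 t) :=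
    ((continuous_star.comp_continuousOn hU.cont).mul hU.cont).mono hsub
  have key := MeasureTheory.integral_eq_of_hasDerivAt_off_countable_of_le
    (fun r => star (U r) * U r) (fun _ => 0) ht.1 hs hc (by
      intro r hr
      have hr' : r ∈ Ioo 0 τ \ s := ⟨⟨hr.1.1, hr.1.2.trans_le ht.2⟩, hr.2⟩
      have h := (hd r hr').star.mul (hd r hr')
      have hHr : (H r)ᴴ = H r := (hH r ⟨hr'.1.1.le, hr'.1.2.le⟩).eq
      have e : star (-Complex.I • (H r * U r)) * U r
          + star (U r) * -Complex.I • (H r * U r) = 0 := by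
        rw [star_smul, star_mul, Matrix.star_eq_conjTranspose (H r), hHr]
        simp [mul_assoc]
      rw [e] at h
      exact h) (by simp)
  rw [hU.init] at key
  simp only [intervalIntegral.integral_zero, star_one, one_mul] at key
  rw [Matrix.mem_unitaryGroup_iff']
  exact (sub_eq_zero.1 key.symm)

/-! Integrated entropy production. -/

theorem integrable_trace_mul {τ R S : ℝ} {K M : ℝ → Op d}
    (hK : AEStronglyMeasurable K (volume.restrict (Icc 0 τ)))
    (hM : AEStronglyMeasurable M (volume.restrict (Icc 0 τ)))
    (hR : ∀ t ∈ Icc 0 τ, ‖K t‖ ≤ R) (hS : ∀ t ∈ Icc 0 τ, ‖M t‖ ≤ S) :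
    IntegrableOn (fun t => ((K t * M t).trace).re) (Icc 0 τ) := by
  refine Integrable.of_bound ((reTraceCLM d).continuous.comp_aestronglyMeasurable (hK.mul hM))
    (‖reTraceCLM d‖ * (R * S)) ?_
  filter_upwards [ae_restrict_mem measurableSet_Icc] with t ht
  refine ((reTraceCLM d).le_opNorm _).trans ?_
  refine mul_le_mul_of_nonneg_left ?_ (norm_nonneg _)
  exact (norm_mul_le _ _).trans (mul_le_mul (hR t ht) (hS t ht) (norm_nonneg _)
    ((norm_nonneg (K t)).trans (hR t ht)))

theorem ae_mem_Ioo_diff (τ : ℝ) {s : Set ℝ} (hs : s.Countable) :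
    ∀ᵐ t ∂(volume.restrict (Icc 0 τ)), t ∈ Ioo 0 τ \ s := by
  rw [← Measure.restrict_congr_set Ioo_ae_eq_Icc]
  filter_upwards [ae_restrict_mem measurableSet_Ioo, ae_restrict_of_ae (hs.ae_notMem volume)]
    with t h1 h2 using ⟨h1, h2⟩

section Integrated

variable {β τ : ℝ} {H V ρ : ℝ → Op d} {ε : ℝ → Fin d → ℝ} {L : ι → ℝ → Op d} {ω : ι → ℝ → ℝ}
  {rev : ι → ι}

theorem IsThermalProtocol.isHermitian (hT : IsThermalProtocol β τ H V ε L ω rev) {t : ℝ}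
    (ht : t ∈ Icc 0 τ) : (H t).IsHermitian :=
  isHermitian_of_eigenbasis (hT.unitary t ht) (hT.eigenbasis t ht)

/-- The entropy production rate with the regularized logarithm `ln (ρ + δ)`. -/
def regRate (β : ℝ) (H ρ : ℝ → Op d) (L : ι → ℝ → Op d) (δ t : ℝ) : ℝ :=
  ((-cfc Real.log (ρ t + (δ : ℂ) • 1) * lindblad (H t) (fun k => L k t) (ρ t)).trace).re
    - β * ((H t * lindblad (H t) (fun k => L k t) (ρ t)).trace).re

/-- The logarithm is regularized but the generator still acts on ρ itself, which is the true
derivative of ρ + δ. The integral is therefore exact, and the +1 in the derivative of the entropy is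
lost because the generator is traceless. -/
theorem integral_regRate (hτ : 0 < τ) (hT : IsThermalProtocol β τ H V ε L ω rev)
    (hρ : IsLindbladPath τ H L ρ) {δ : ℝ} (hδ : 0 < δ) (hδ1 : δ ≤ 1) :
    IntegrableOn (regRate β H ρ L δ) (Icc 0 τ) ∧
      ∫ t in Icc 0 τ, regRate β H ρ L δ t
        = β * heat τ H ρ - (entropy (ρ 0 + (δ : ℂ) • 1) - entropy (ρ τ + (δ : ℂ) • 1)) := by
  obtain ⟨B, hB⟩ := hT.bounded
  obtain ⟨R, hR⟩ := isCompact_Icc.exists_bound_of_continuousOn hρ.cont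
  obtain ⟨s, hs, hder⟩ := hρ.master
  have h0 : (0 : ℝ) ∈ Icc 0 τ := ⟨le_rfl, hτ.le⟩
  have hρm : AEStronglyMeasurable ρ (volume.restrict (Icc 0 τ)) :=
    hρ.cont.aestronglyMeasurable measurableSet_Icc
  have hGm := aestronglyMeasurable_lindblad hT.meas_H hT.meas_L hρm
  have hlogc := continuousOn_cfc_log_add hρ.cont hρ.density hδ
  have hlogm : AEStronglyMeasurable (fun t => -cfc Real.log (ρ t + (δ : ℂ) • 1))
      (volume.restrict (Icc 0 τ)) := hlogc.neg.aestronglyMeasurable measurableSet_Icc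
  have hB0 : 0 ≤ B := (norm_nonneg _).trans (hB 0 h0).1
  have hGb : ∀ t ∈ Icc 0 τ, ‖lindblad (H t) (fun k => L k t) (ρ t)‖
      ≤ (2 * B + Fintype.card ι * (2 * B ^ 2)) * R := fun t ht =>
    (norm_lindblad_le (hB t ht).1 (hB t ht).2 _).trans
      (mul_le_mul_of_nonneg_left (hR t ht) (by positivity))
  have i1 : IntegrableOn (fun t => ((-cfc Real.log (ρ t + (δ : ℂ) • 1) *
      lindblad (H t) (fun k => L k t) (ρ t)).trace).re) (Icc 0 τ) :=
    integrable_trace_mul hlogm hGm (R := 1 - Real.log δ)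
      (fun t ht => by rw [norm_neg]; exact norm_cfc_log_add_le (hρ.density t ht) hδ hδ1) hGb
  have i2 : IntegrableOn (fun t => ((H t * lindblad (H t) (fun k => L k t) (ρ t)).trace).re)
      (Icc 0 τ) := integrable_trace_mul hT.meas_H hGm (fun t ht => (hB t ht).1) hGb
  refine ⟨i1.sub (i2.const_mul β), ?_⟩
  have e2 : ∫ t in Icc 0 τ, ((H t * lindblad (H t) (fun k => L k t) (ρ t)).trace).re
      = -heat τ H ρ := by
    rw [heat, neg_neg, intervalIntegral.integral_of_le hτ.le, ← integral_Icc_eq_integral_Ioc]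
    refine integral_congr_ae ?_
    filter_upwards [ae_mem_Ioo_diff τ hs] with t ht
    rw [(hder t ht).deriv]
  have e1 : ∫ t in Icc 0 τ, ((-cfc Real.log (ρ t + (δ : ℂ) • 1) *
      lindblad (H t) (fun k => L k t) (ρ t)).trace).re
      = entropy (ρ τ + (δ : ℂ) • 1) - entropy (ρ 0 + (δ : ℂ) • 1) := by
    rw [integral_Icc_eq_integral_Ioc, ← intervalIntegral.integral_of_le hτ.le]
    refine MeasureTheory.integral_eq_of_hasDerivAt_off_countable_of_le
      (fun t => entropy (ρ t + (δ : ℂ) • 1)) _ hτ.le hs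
      (continuousOn_entropy_add hρ.cont hρ.density δ) ?_ ?_
    · intro t ht
      have hn : Icc 0 τ ∈ 𝓝 t := Icc_mem_nhds ht.1.1 ht.1.2
      have h := hasDerivAt_entropy ((hder t ht).add_const ((δ : ℂ) • (1 : Op d)))
        (by filter_upwards [hn] with r hr using (hρ.density r hr).posDef_add hδ)
        (hlogc.continuousAt hn)
      rwa [mul_add, mul_one, Matrix.trace_add, trace_lindblad, add_zero, Matrix.trace_mul_comm,
        ← Complex.neg_re, ← Matrix.trace_neg, ← neg_mul] at h
    · rw [intervalIntegrable_iff_integrableOn_Icc_of_le hτ.le]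
      exact i1
  simp only [regRate]
  rw [integral_sub i1 (i2.const_mul β), integral_const_mul, e1, e2]
  ring

/-- The error caused by replacing `ln ρ` by `ln (ρ + δ)`. -/
theorem regRate_lower_bound (hβ : 0 < β) (hT : IsThermalProtocol β τ H V ε L ω rev)
    (hρ : IsLindbladPath τ H L ρ) :
    ∃ N : ℝ, ∀ δ : ℝ, 0 < δ → δ ≤ 1 → ∀ t ∈ Icc 0 τ, ∀ X : Op d, X.IsHermitian →
      ((X * ∑ k, dissipator (L k t) 1).trace).re = 0 → ∀ s : ℝ,
      4 * s * ((X * ∑ k, dissipator (L k t) (ρ t)).trace).re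
        - 2 * s ^ 2 * (1 + d * δ) * ∑ k, ‖opComm (L k t) X‖ ^ 2
      ≤ regRate β H ρ L δ t + N * (δ * (2 - Real.log δ)) := by
  obtain ⟨B, hB⟩ := hT.bounded
  set T := ‖reTraceCLM d‖ with hTdef
  set N₁ := (2 * B + Fintype.card ι * (2 * B ^ 2)) * ‖(1 : Op d)‖ with hN₁
  -- T bounds the trace functional and N₁ the generator at the identity. The logarithm contributes a
  -- factor 1 − ln δ and the energy term a factor βB; both are covered by (1 + βB)(2 − ln δ).
  refine ⟨T * N₁ * (1 + β * B), fun δ hδ hδ1 t ht X hX h1 s => ?_⟩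
  have hB0 : 0 ≤ B := (norm_nonneg _).trans (hB t ht).1
  have hT0 : 0 ≤ T := norm_nonneg _
  have hN0 : 0 ≤ N₁ := by positivity
  have hpos := (hρ.density t ht).posDef_add hδ
  -- The inequality holds for ρ + δ. By linearity the generator splits off δ times its value at the
  -- identity, which is the error on the right and vanishes on the left by `h1`.
  have key := entropy_production_le (β := β) (s := s) (ω := fun k => ω k t) (L := fun k => L k t)
    hT.rev_rev (fun k => hT.detailed_balance k t ht) (hT.isHermitian ht)
    (fun k => hT.energy_change k t ht) hpos hX
  have e1 : ((X * ∑ k, dissipator (L k t) (ρ t + (δ : ℂ) • 1)).trace).re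
      = ((X * ∑ k, dissipator (L k t) (ρ t)).trace).re := by
    simp only [dissipator_add_smul, Finset.sum_add_distrib, ← Finset.smul_sum]
    rw [mul_add, Matrix.mul_smul, Matrix.trace_add, Matrix.trace_smul, smul_eq_mul, Complex.add_re,
      Complex.re_ofReal_mul, h1]
    ring
  have e2 : (ρ t + (δ : ℂ) • 1).trace.re = 1 + d * δ := by
    rw [Matrix.trace_add, (hρ.density t ht).2, Matrix.trace_smul, Matrix.trace_one]
    simp [mul_comm]
  have hl1 : ‖lindblad (H t) (fun k => L k t) (1 : Op d)‖ ≤ N₁ :=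
    norm_lindblad_le (hB t ht).1 (hB t ht).2 _
  have hlog := norm_cfc_log_add_le (hρ.density t ht) hδ hδ1
  have b1 : ((-cfc Real.log (ρ t + (δ : ℂ) • 1) *
      lindblad (H t) (fun k => L k t) (1 : Op d)).trace).re ≤ T * ((1 - Real.log δ) * N₁) := by
    refine (le_abs_self _).trans (((reTraceCLM d).le_opNorm _).trans ?_)
    refine mul_le_mul_of_nonneg_left ?_ hT0
    refine (norm_mul_le _ _).trans ?_
    rw [norm_neg]
    exact mul_le_mul hlog hl1 (norm_nonneg _) ((norm_nonneg _).trans hlog)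
  have b2 : -((H t * lindblad (H t) (fun k => L k t) (1 : Op d)).trace).re ≤ T * (B * N₁) := by
    refine (neg_le_abs _).trans (((reTraceCLM d).le_opNorm _).trans ?_)
    refine mul_le_mul_of_nonneg_left ?_ hT0
    exact (norm_mul_le _ _).trans (mul_le_mul (hB t ht).1 hl1 (norm_nonneg _) hB0)
  rw [e1, e2, lindblad_add_smul] at key
  simp only [mul_add, Matrix.mul_smul, Matrix.trace_add, Matrix.trace_smul, smul_eq_mul,
    Complex.add_re, Complex.re_ofReal_mul] at key
  rw [regRate]
  have hl := Real.log_nonpos hδ.le hδ1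
  have c1 := mul_le_mul_of_nonneg_left b1 hδ.le
  have c2 := mul_le_mul_of_nonneg_left (mul_le_mul_of_nonneg_left b2 hβ.le) hδ.le
  have c3 : δ * (T * ((1 - Real.log δ) * N₁)) + δ * (β * (T * (B * N₁)))
      ≤ T * N₁ * (1 + β * B) * (δ * (2 - Real.log δ)) := by
    have : 0 ≤ δ * T * N₁ * (1 + β * B * (1 - Real.log δ)) := by
      have : 0 ≤ 1 - Real.log δ := by linarith
      positivity
    linarith
  linarith

/-- Only the majorant's lower integral enters, so g need not be measurable; this spares a
measurability proof for X. -/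
theorem integral_le_toReal_lintegral {μ : Measure ℝ} {f g : ℝ → ℝ} (hf : Integrable f μ)
    (hfg : ∀ᵐ t ∂μ, f t ≤ g t) (hg : ∫⁻ t, ENNReal.ofReal (g t) ∂μ ≠ ⊤) :
    ∫ t, f t ∂μ ≤ (∫⁻ t, ENNReal.ofReal (g t) ∂μ).toReal := by
  rw [integral_eq_lintegral_pos_part_sub_lintegral_neg_part hf]
  have h1 : (∫⁻ t, ENNReal.ofReal (f t) ∂μ).toReal ≤ (∫⁻ t, ENNReal.ofReal (g t) ∂μ).toReal :=
    ENNReal.toReal_mono hg (lintegral_mono_ae (by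
      filter_upwards [hfg] with t ht using ENNReal.ofReal_le_ofReal ht))
  linarith [ENNReal.toReal_nonneg (a := ∫⁻ t, ENNReal.ofReal (-f t) ∂μ)]

/-- The linearized form of the entropy production bound. -/
theorem linear_bound_le_entropy_production (hβ : 0 < β) (hτ : 0 < τ)
    (hT : IsThermalProtocol β τ H V ε L ω rev) (hρ : IsLindbladPath τ H L ρ) {X : ℝ → Op d}
    (hX : ∀ t ∈ Icc 0 τ, (X t).IsHermitian)
    (h1 : ∀ t ∈ Icc 0 τ, ((X t * ∑ k, dissipator (L k t) 1).trace).re = 0) {c : ℝ → ℝ}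
    (hc : IntegrableOn c (Icc 0 τ))
    (hcX : ∀ t ∈ Icc 0 τ, c t = -2 * ((X t * ∑ k, dissipator (L k t) (ρ t)).trace).re)
    (hG : ∫⁻ t in Icc 0 τ, ENNReal.ofReal (∑ k, ‖opComm (L k t) (X t)‖ ^ 2) ≠ ⊤) (s : ℝ) :
    2 * s * (∫ t in Icc 0 τ, c t)
      - 2 * s ^ 2 *
        (∫⁻ t in Icc 0 τ, ENNReal.ofReal (∑ k, ‖opComm (L k t) (X t)‖ ^ 2)).toReal
    ≤ β * heat τ H ρ - entropyDrop τ ρ := by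
  obtain ⟨N, hN⟩ := regRate_lower_bound hβ hT hρ
  set G := ∫⁻ t in Icc 0 τ, ENNReal.ofReal (∑ k, ‖opComm (L k t) (X t)‖ ^ 2) with hGdef
  have step : ∀ δ : ℝ, 0 < δ → δ ≤ 1 → 2 * s * ∫ t in Icc 0 τ, c t
      ≤ (β * heat τ H ρ - (entropy (ρ 0 + (δ : ℂ) • 1) - entropy (ρ τ + (δ : ℂ) • 1)))
        + τ * (N * (δ * (2 - Real.log δ))) + 2 * s ^ 2 * (1 + d * δ) * G.toReal := by
    intro δ hδ hδ1
    obtain ⟨i1, e1⟩ := integral_regRate hτ hT hρ hδ hδ1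
    have hd : 0 ≤ 2 * s ^ 2 * (1 + d * δ) := by positivity
    have hc' : IntegrableOn (fun t => 2 * s * c t - (regRate β H ρ L δ t
        + N * (δ * (2 - Real.log δ)))) (Icc 0 τ) :=
      (hc.const_mul _).sub (i1.add (integrable_const _))
    have hle := integral_le_toReal_lintegral hc' (g := fun t => 2 * s ^ 2 * (1 + d * δ) *
        ∑ k, ‖opComm (L k t) (X t)‖ ^ 2) (by
      filter_upwards [ae_restrict_mem measurableSet_Icc] with t ht
      -- The parameter is −s because c carries the factor −2 in front of the trace.
      have := hN δ hδ hδ1 t ht (X t) (hX t ht) (h1 t ht) (-s)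
      rw [hcX t ht]
      rw [neg_sq] at this
      linarith)
    have hlin : ∫⁻ t in Icc 0 τ, ENNReal.ofReal (2 * s ^ 2 * (1 + d * δ) *
        ∑ k, ‖opComm (L k t) (X t)‖ ^ 2) = ENNReal.ofReal (2 * s ^ 2 * (1 + d * δ)) * G := by
      simp only [ENNReal.ofReal_mul hd]
      rw [lintegral_const_mul' _ _ ENNReal.ofReal_ne_top]
    rw [hlin] at hle
    have hle := hle (ENNReal.mul_ne_top ENNReal.ofReal_ne_top hG)
    have hsub : ∫ t in Icc 0 τ, (2 * s * c t - (regRate β H ρ L δ t + N * (δ * (2 - Real.log δ))))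
        = (∫ t in Icc 0 τ, 2 * s * c t)
          - ∫ t in Icc 0 τ, (regRate β H ρ L δ t + N * (δ * (2 - Real.log δ))) :=
      integral_sub (hc.const_mul _) (i1.add (integrable_const _))
    rw [ENNReal.toReal_mul, ENNReal.toReal_ofReal hd, hsub,
      integral_add i1 (integrable_const _), integral_const_mul, e1] at hle
    simp only [integral_const, smul_eq_mul] at hle
    have hvol : (volume.restrict (Icc (0 : ℝ) τ)).real univ = τ := by
      simp [Measure.real, hτ.le]
    rw [hvol] at hle
    linarith
  -- Letting δ → 0 removes the error, since δ ln δ → 0, and turns the regularized entropies into the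
  -- true ones.
  have t0 : Tendsto (fun δ : ℝ => δ) (𝓝[>] 0) (𝓝 0) := tendsto_id.mono_left nhdsWithin_le_nhds
  have tlog : Tendsto (fun δ : ℝ => δ * (2 - Real.log δ)) (𝓝[>] 0) (𝓝 0) := by
    have h := (Real.continuous_mul_log.tendsto 0).mono_left
      (nhdsWithin_le_nhds (s := Ioi (0 : ℝ)))
    have := (t0.mul_const 2).sub h
    simp only [zero_mul, sub_zero] at this
    exact this.congr fun δ => by ring
  have lim : Tendsto (fun δ : ℝ =>
      (β * heat τ H ρ - (entropy (ρ 0 + (δ : ℂ) • 1) - entropy (ρ τ + (δ : ℂ) • 1)))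
        + τ * (N * (δ * (2 - Real.log δ))) + 2 * s ^ 2 * (1 + d * δ) * G.toReal) (𝓝[>] 0)
      (𝓝 ((β * heat τ H ρ - (entropy (ρ 0) - entropy (ρ τ))) + τ * (N * 0)
        + 2 * s ^ 2 * (1 + d * 0) * G.toReal)) := by
    have d0 := tendsto_entropy_add (hρ.density 0 ⟨le_rfl, hτ.le⟩)
    have d1 := tendsto_entropy_add (hρ.density τ ⟨hτ.le, le_rfl⟩)
    exact ((tendsto_const_nhds.sub (d0.sub d1)).add ((tlog.const_mul N).const_mul τ)).add
      (((tendsto_const_nhds.add (t0.const_mul _)).const_mul _).mul_const _)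
  have := ge_of_tendsto lim (by
    filter_upwards [Ioc_mem_nhdsGT zero_lt_one] with δ hδ using step δ hδ.1 hδ.2)
  rw [entropyDrop]
  linarith

theorem integrableOn_coherenceL1 (hT : IsThermalProtocol β τ H V ε L ω rev)
    (hρ : IsLindbladPath τ H L ρ) :
    IntegrableOn (fun t => coherenceL1 (V t) (ρ t)) (Icc 0 τ) := by
  obtain ⟨R, hR⟩ := isCompact_Icc.exists_bound_of_continuousOn hρ.cont
  have hm : AEStronglyMeasurable (fun t => rep (V t) (ρ t)) (volume.restrict (Icc 0 τ)) :=
    (((continuous_star (R := Op d)).comp_aestronglyMeasurable hT.meas_V).mul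
      (hρ.cont.aestronglyMeasurable measurableSet_Icc)).mul hT.meas_V
  refine integrable_finsetSum _ fun m _ => integrable_finsetSum _ fun n _ => ?_
  by_cases hmn : m = n
  · simp [hmn]
  · simp only [if_neg hmn]
    have hmeas : AEStronglyMeasurable (fun t => ‖rep (V t) (ρ t) m n‖)
        (volume.restrict (Icc 0 τ)) :=
      (continuous_norm.comp (continuous_id.matrix_elem m n)).comp_aestronglyMeasurable hm
    refine Integrable.of_bound hmeas R ?_
    filter_upwards [ae_restrict_mem measurableSet_Icc] with t ht
    rw [norm_norm]
    exact (norm_apply_le _ m n).trans ((norm_rep (hT.unitary t ht) _).le.trans (hR t ht))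

/-- Conjugation by the unitary U respects commutators and the spectral norm, so the interaction
picture can be dropped. -/
theorem gammaR_interaction {U X X₀ : ℝ → Op d}
    (hU : ∀ t ∈ Icc 0 τ, U t ∈ Matrix.unitaryGroup (Fin d) ℂ)
    (hX : ∀ t ∈ Icc 0 τ, X t = interaction (U t) (X₀ t)) :
    gammaR τ L U X = ((ENNReal.ofReal τ)⁻¹ *
      ∫⁻ t in Icc 0 τ, ENNReal.ofReal (∑ k, ‖opComm (L k t) (X₀ t)‖ ^ 2))⁻¹ := by
  have key : ∫⁻ t in Icc 0 τ, ENNReal.ofReal (∑ k, ‖opComm (interaction (U t) (L k t)) (X t)‖ ^ 2)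
      = ∫⁻ t in Icc 0 τ, ENNReal.ofReal (∑ k, ‖opComm (L k t) (X₀ t)‖ ^ 2) := by
    refine setLIntegral_congr_fun measurableSet_Icc fun t ht => ?_
    have h : ∀ k, ‖opComm (interaction (U t) (L k t)) (X t)‖ = ‖opComm (L k t) (X₀ t)‖ := by
      intro k
      rw [hX t ht, ← norm_rep (hU t ht) (opComm (L k t) (X₀ t)), rep_opComm (hU t ht)]
      rfl
    simp only [h]
  rw [gammaR, key]

/-- The bound on the dissipated heat for an operator `X` that detects the coherence. -/
theorem heat_bound (hβ : 0 < β) (hτ : 0 < τ) (hT : IsThermalProtocol β τ H V ε L ω rev)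
    (hρ : IsLindbladPath τ H L ρ) {U X X₀ : ℝ → Op d}
    (hU : ∀ t ∈ Icc 0 τ, U t ∈ Matrix.unitaryGroup (Fin d) ℂ)
    (hX : ∀ t ∈ Icc 0 τ, X t = interaction (U t) (X₀ t))
    (hX₀ : ∀ t ∈ Icc 0 τ, (X₀ t).IsHermitian)
    (h1 : ∀ t ∈ Icc 0 τ, ((X₀ t * ∑ k, dissipator (L k t) 1).trace).re = 0)
    (hc : ∀ t ∈ Icc 0 τ,
      coherenceL1 (V t) (ρ t) = -2 * ((X₀ t * ∑ k, dissipator (L k t) (ρ t)).trace).re)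
    (hne : gammaR τ L U X ≠ ⊤) :
    β * heat τ H ρ ≥
      entropyDrop τ ρ + (gammaR τ L U X).toReal * coherence τ V ρ ^ 2 / (2 * τ) := by
  -- The second law, from X = 0. It is all that is claimed when G = ∞, since the rate is then 0.
  have hnonneg : 0 ≤ β * heat τ H ρ - entropyDrop τ ρ := by
    have := linear_bound_le_entropy_production hβ hτ hT hρ (X := fun _ => 0) (c := fun _ => 0)
      (fun _ _ => Matrix.isHermitian_zero) (by simp) integrableOn_zero (by simp)
      (by simp [opComm]) 0
    simpa using this
  rw [gammaR_interaction hU hX] at hne ⊢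
  set G := ∫⁻ t in Icc 0 τ, ENNReal.ofReal (∑ k, ‖opComm (L k t) (X₀ t)‖ ^ 2) with hG
  have hτ' : (ENNReal.ofReal τ)⁻¹ ≠ 0 := ENNReal.inv_ne_zero.2 ENNReal.ofReal_ne_top
  by_cases hGt : G = ⊤
  · rw [hGt, ENNReal.mul_top hτ']
    simp
    linarith
  have hG0 : 0 < G.toReal := by
    refine ENNReal.toReal_pos (fun h => hne ?_) hGt
    rw [h, mul_zero, ENNReal.inv_zero]
  have hval : ((ENNReal.ofReal τ)⁻¹ * G)⁻¹.toReal = τ / G.toReal := by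
    rw [ENNReal.toReal_inv, ENNReal.toReal_mul, ENNReal.toReal_inv, ENNReal.toReal_ofReal hτ.le]
    field_simp
  rw [hval]
  have hcoh : coherence τ V ρ = ∫ t in Icc 0 τ, coherenceL1 (V t) (ρ t) := by
    rw [coherence, intervalIntegral.integral_of_le hτ.le, integral_Icc_eq_integral_Ioc]
  -- This s maximizes 2sC − 2s²G, with value C²/(2G).
  have key := linear_bound_le_entropy_production hβ hτ hT hρ hX₀ h1
    (integrableOn_coherenceL1 hT hρ) hc hGt (coherence τ V ρ / (2 * G.toReal))
  rw [← hcoh, ← hG] at key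
  have e : τ / G.toReal * coherence τ V ρ ^ 2 / (2 * τ)
      = 2 * (coherence τ V ρ / (2 * G.toReal)) * coherence τ V ρ
        - 2 * (coherence τ V ρ / (2 * G.toReal)) ^ 2 * G.toReal := by
    field_simp
    ring
  rw [e]
  linarith

theorem gammaR_ne_top (hτ : 0 < τ) {U X X₀ : ℝ → Op d}
    (hU : ∀ t ∈ Icc 0 τ, U t ∈ Matrix.unitaryGroup (Fin d) ℂ)
    (hX : ∀ t ∈ Icc 0 τ, X t = interaction (U t) (X₀ t)) {b : ℝ} (hb : 0 < b)
    (h : ∀ t ∈ Icc 0 τ, b ≤ ∑ k, ‖opComm (L k t) (X₀ t)‖ ^ 2) : gammaR τ L U X ≠ ⊤ := by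
  rw [gammaR_interaction hU hX]
  have h1 : ENNReal.ofReal b * ENNReal.ofReal τ
      ≤ ∫⁻ t in Icc 0 τ, ENNReal.ofReal (∑ k, ‖opComm (L k t) (X₀ t)‖ ^ 2) := by
    calc ENNReal.ofReal b * ENNReal.ofReal τ = ∫⁻ _t in Icc 0 τ, ENNReal.ofReal b := by
          rw [setLIntegral_const, Real.volume_Icc, sub_zero]
      _ ≤ _ := setLIntegral_mono' measurableSet_Icc fun t ht => ENNReal.ofReal_le_ofReal (h t ht)
  have h2 : 0 < ENNReal.ofReal b * ENNReal.ofReal τ :=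
    ENNReal.mul_pos (ENNReal.ofReal_pos.2 hb).ne' (ENNReal.ofReal_pos.2 hτ).ne'
  exact ENNReal.inv_ne_top.2
    (mul_ne_zero (ENNReal.inv_ne_zero.2 ENNReal.ofReal_ne_top) (h2.trans_le h1).ne')

end Integrated

end

section

variable {d : ℕ} {ι : Type*}

/-! The adjoint of the dissipator. -/

/-- The dissipator in the Heisenberg picture: `L† A L - (1/2) {L† L, A}`. -/
def adjDissipator (L A : Op d) : Op d :=
  Lᴴ * A * L - (1 / 2 : ℂ) • (Lᴴ * L * A + A * (Lᴴ * L))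

theorem trace_mul_dissipator (L A ρ : Op d) :
    (A * dissipator L ρ).trace = (adjDissipator L A * ρ).trace := by
  have h1 : (A * (L * ρ * Lᴴ)).trace = (Lᴴ * A * L * ρ).trace := by
    rw [← mul_assoc, Matrix.trace_mul_comm]
    congr 1
    simp only [mul_assoc]
  have h2 : (A * (Lᴴ * L * ρ)).trace = (A * (Lᴴ * L) * ρ).trace := by
    simp only [mul_assoc]
  have h3 : (A * (ρ * (Lᴴ * L))).trace = (Lᴴ * L * A * ρ).trace := by
    rw [← mul_assoc, Matrix.trace_mul_comm]
    simp only [mul_assoc]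
  rw [dissipator, adjDissipator, mul_sub, sub_mul, Matrix.trace_sub, Matrix.trace_sub, h1,
    Matrix.mul_smul, Matrix.smul_mul, mul_add, add_mul, Matrix.trace_smul, Matrix.trace_smul,
    Matrix.trace_add, Matrix.trace_add, h2, h3, add_comm (A * (Lᴴ * L) * ρ).trace]

theorem adjDissipator_conjTranspose (L A : Op d) :
    adjDissipator L Aᴴ = (adjDissipator L A)ᴴ := by
  simp only [adjDissipator, Matrix.conjTranspose_sub, Matrix.conjTranspose_smul,
    Matrix.conjTranspose_add, Matrix.conjTranspose_mul, Matrix.conjTranspose_conjTranspose,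
    mul_assoc]
  rw [add_comm (Lᴴ * (L * Aᴴ))]
  simp

theorem adjDissipator_sub (L A B : Op d) :
    adjDissipator L (A - B) = adjDissipator L A - adjDissipator L B := by
  simp only [adjDissipator, mul_sub, sub_mul]
  module

/-- The carré du champ identity: the failure of the Leibniz rule is a positive square of the
commutator. -/
theorem adjDissipator_conjTranspose_mul_self (L A : Op d) :
    adjDissipator L (Aᴴ * A) = adjDissipator L Aᴴ * A + Aᴴ * adjDissipator L A
      + (opComm L A)ᴴ * opComm L A := by
  simp only [adjDissipator, opComm, Matrix.conjTranspose_sub, Matrix.conjTranspose_mul, mul_sub,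
    sub_mul, mul_add, add_mul, Matrix.smul_mul, Matrix.mul_smul, mul_assoc]
  module

/-- For self-adjoint A both halves contain [L, A] or its adjoint, each with weight ½. -/
theorem norm_adjDissipator_le (L : Op d) {A : Op d} (hA : A.IsHermitian) :
    ‖adjDissipator L A‖ ≤ ‖L‖ * ‖opComm L A‖ := by
  have h : adjDissipator L A = (1 / 2 : ℂ) • (-(Lᴴ * opComm L A) - (opComm L A)ᴴ * L) := by
    simp only [adjDissipator, opComm, Matrix.conjTranspose_sub, Matrix.conjTranspose_mul, mul_sub,
      sub_mul, hA.eq, mul_assoc]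
    module
  have h1 : ‖Lᴴ * opComm L A‖ ≤ ‖L‖ * ‖opComm L A‖ := by
    refine (norm_mul_le _ _).trans ?_
    rw [Matrix.l2_opNorm_conjTranspose]
  have h2 : ‖(opComm L A)ᴴ * L‖ ≤ ‖L‖ * ‖opComm L A‖ := by
    refine (norm_mul_le _ _).trans ?_
    rw [Matrix.l2_opNorm_conjTranspose, mul_comm]
  have h3 := norm_sub_le (-(Lᴴ * opComm L A)) ((opComm L A)ᴴ * L)
  rw [norm_neg] at h3
  rw [h, norm_smul]
  have : ‖(1 / 2 : ℂ)‖ = 1 / 2 := by simp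
  rw [this]
  linarith

/-! ### Jumps of definite energy change: Gibbs stationarity, kernel of the adjoint dissipator,
matrix entries. -/

section Jumps

variable {β : ℝ} {ω : ι → ℝ} {rev : ι → ι} {l : ι → Op d} {ε : Fin d → ℝ}

/-- The Gibbs state is stationary. -/
theorem trace_gibbs_mul_adjDissipator [Fintype ι] (hrev : Function.Involutive rev)
    (hdb : ∀ k, l k = (Real.exp (β * ω k / 2) : ℂ) • (l (rev k))ᴴ)
    (hj : ∀ k m n, l k n m ≠ 0 → ε m - ε n = ω k) (Y : Op d) :
    ∑ k, ((Matrix.diagonal fun n => (Real.exp (-(β * ε n)) : ℂ)) *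
      adjDissipator (l k) Y).trace = 0 := by
  set P : Op d := Matrix.diagonal fun n => (Real.exp (-(β * ε n)) : ℂ) with hP
  have hPh : Pᴴ = P := by
    rw [hP, Matrix.diagonal_conjTranspose]; congr 1; ext n; exact Complex.conj_ofReal _
  have c1 : ∀ k, l k * P = (Real.exp (-(β * ω k)) : ℂ) • (P * l k) := by
    intro k
    ext n m
    rw [hP, Matrix.mul_diagonal, Matrix.smul_apply, Matrix.diagonal_mul, smul_eq_mul]
    by_cases h : l k n m = 0
    · simp [h]
    · have := hj k m n h
      have e : Real.exp (-(β * ε m)) = Real.exp (-(β * ω k)) * Real.exp (-(β * ε n)) := by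
        rw [← Real.exp_add, ← this]; congr 1; ring
      rw [e]; push_cast; ring
  have c2 : ∀ k, P * (l k)ᴴ = (Real.exp (-(β * ω k)) : ℂ) • ((l k)ᴴ * P) := by
    intro k
    have := congrArg Matrix.conjTranspose (c1 k)
    simpa [Matrix.conjTranspose_mul, Matrix.conjTranspose_smul, hPh, ← Complex.ofReal_exp]
      using this
  have c3 : ∀ k, P * ((l k)ᴴ * l k) = (l k)ᴴ * l k * P := by
    intro k
    rw [← mul_assoc, c2, Matrix.smul_mul, mul_assoc, mul_assoc, c1, Matrix.mul_smul]
  have c4 : ∀ k, l k * (l k)ᴴ = (Real.exp (β * ω k) : ℂ) • ((l (rev k))ᴴ * l (rev k)) := by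
    intro k
    conv_lhs => rw [hdb k]
    rw [Matrix.conjTranspose_smul, Matrix.conjTranspose_conjTranspose, Matrix.smul_mul,
      Matrix.mul_smul, smul_smul]
    congr 1
    rw [Complex.star_def, Complex.conj_ofReal, ← Complex.ofReal_mul, ← Real.exp_add]
    congr 2; ring
  -- The factor e^{−βω} from moving L past the Gibbs weight cancels e^{βω} from detailed balance:
  -- the gain term of k is the loss term of the reversed jump.
  have t1 : ∀ k, (P * ((l k)ᴴ * Y * l k)).trace
      = (P * ((l (rev k))ᴴ * l (rev k)) * Y).trace := by
    intro k
    calc (P * ((l k)ᴴ * Y * l k)).trace = (l k * P * (l k)ᴴ * Y).trace := by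
          rw [Matrix.trace_mul_comm, mul_assoc, mul_assoc, Matrix.trace_mul_comm]
          simp only [mul_assoc]
          rw [Matrix.trace_mul_comm]
          simp only [mul_assoc]
      _ = _ := by
          rw [c1, Matrix.smul_mul, mul_assoc P, c4, Matrix.mul_smul, smul_smul,
            ← Complex.ofReal_mul, ← Real.exp_add]
          simp
  have t2 : ∀ k, (P * (Y * ((l k)ᴴ * l k))).trace = (P * ((l k)ᴴ * l k) * Y).trace := by
    intro k
    rw [c3, ← mul_assoc, Matrix.trace_mul_comm, ← mul_assoc]
  have t3 : ∀ k, (P * adjDissipator (l k) Y).trace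
      = (P * ((l (rev k))ᴴ * l (rev k)) * Y).trace - (P * ((l k)ᴴ * l k) * Y).trace := by
    intro k
    rw [adjDissipator, mul_sub, Matrix.trace_sub, t1, Matrix.mul_smul, Matrix.trace_smul, mul_add,
      Matrix.trace_add, t2, ← mul_assoc P ((l k)ᴴ * l k) Y, smul_eq_mul]
    ring
  simp only [t3, Finset.sum_sub_distrib]
  rw [sub_eq_zero]
  exact Equiv.sum_comp hrev.toPerm (fun k => (P * ((l k)ᴴ * l k) * Y).trace)

/-- Gibbs stationarity is applied to M†M. The terms with D†M and D†M† vanish, leaving squared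
commutator entries with strictly positive Gibbs weights and total zero. -/
theorem opComm_eq_zero_of_adjDissipator [Fintype ι] (hrev : Function.Involutive rev)
    (hdb : ∀ k, l k = (Real.exp (β * ω k / 2) : ℂ) • (l (rev k))ᴴ)
    (hj : ∀ k m n, l k n m ≠ 0 → ε m - ε n = ω k) {M : Op d}
    (hM : ∑ k, adjDissipator (l k) M = 0) (k : ι) : opComm (l k) M = 0 := by
  have h0 := trace_gibbs_mul_adjDissipator hrev hdb hj (Mᴴ * M)
  set P : Op d := Matrix.diagonal fun n => (Real.exp (-(β * ε n)) : ℂ) with hP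
  have hM' : ∑ k, adjDissipator (l k) Mᴴ = 0 := by
    simp only [adjDissipator_conjTranspose]
    rw [← Matrix.conjTranspose_sum, hM, Matrix.conjTranspose_zero]
  have h1 : ∑ k, (P * ((opComm (l k) M)ᴴ * opComm (l k) M)).trace = 0 := by
    rw [← h0, ← Matrix.trace_sum, ← Matrix.trace_sum, ← Finset.mul_sum, ← Finset.mul_sum]
    simp only [adjDissipator_conjTranspose_mul_self, Finset.sum_add_distrib]
    rw [← Finset.sum_mul, ← Finset.mul_sum, hM, hM']
    simp
  have h2 : ∀ k, ((P * ((opComm (l k) M)ᴴ * opComm (l k) M)).trace).re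
      = ∑ j, ∑ i, Real.exp (-(β * ε j)) * ‖opComm (l k) M i j‖ ^ 2 := by
    intro k
    rw [Matrix.trace, Complex.re_sum]
    refine Finset.sum_congr rfl fun j _ => ?_
    rw [Matrix.diag_apply, hP, Matrix.diagonal_mul, Complex.re_ofReal_mul, Matrix.mul_apply,
      Complex.re_sum, Finset.mul_sum]
    refine Finset.sum_congr rfl fun i _ => ?_
    rw [Matrix.conjTranspose_apply, Complex.star_def, ← Complex.normSq_eq_conj_mul_self,
      Complex.ofReal_re, Complex.normSq_eq_norm_sq]
  have h3 := congrArg Complex.re h1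
  rw [Complex.re_sum, Complex.zero_re] at h3
  simp only [h2] at h3
  have nn : ∀ k j i, 0 ≤ Real.exp (-(β * ε j)) * ‖opComm (l k) M i j‖ ^ 2 := fun k j i => by
    positivity
  rw [Finset.sum_eq_zero_iff_of_nonneg fun k _ => Finset.sum_nonneg fun j _ =>
    Finset.sum_nonneg fun i _ => nn k j i] at h3
  have h4 := h3 k (Finset.mem_univ k)
  rw [Finset.sum_eq_zero_iff_of_nonneg fun j _ => Finset.sum_nonneg fun i _ => nn k j i] at h4
  ext i j
  have h5 := h4 j (Finset.mem_univ j)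
  rw [Finset.sum_eq_zero_iff_of_nonneg fun i _ => nn k j i] at h5
  have h6 := h5 i (Finset.mem_univ i)
  have h7 : ‖opComm (l k) M i j‖ ^ 2 = 0 :=
    (mul_eq_zero.1 h6).resolve_left (Real.exp_pos _).ne'
  simpa using h7

/-- An operator that shifts the energy by a fixed nonzero amount and commutes with an irreducible
family of jumps vanishes. -/
theorem eq_zero_of_opComm_eq_zero (hε : Function.Injective ε)
    (hj : ∀ k m n, l k n m ≠ 0 → ε m - ε n = ω k)
    (hirr : ∀ m n, Relation.ReflTransGen (fun a b => ∃ k, l k b a ≠ 0) m n) {M : Op d} {g : ℝ}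
    (hg : g ≠ 0) (hM : ∀ p q, M p q ≠ 0 → ε p - ε q = g) (hc : ∀ k, opComm (l k) M = 0) :
    M = 0 := by
  rcases isEmpty_or_nonempty (Fin d) with he | he
  · ext i; exact he.elim i
  -- M would lower the lowest level if g < 0, or raise the highest one if g > 0, so it kills it.
  have hstart : ∃ q, ∀ p, M p q = 0 := by
    rcases lt_or_gt_of_ne hg with hneg | hpos
    · obtain ⟨q, hq⟩ := Finite.exists_min ε
      refine ⟨q, fun p => ?_⟩
      by_contra h
      have := hM p q h
      linarith [hq p]
    · obtain ⟨q, hq⟩ := Finite.exists_max ε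
      refine ⟨q, fun p => ?_⟩
      by_contra h
      have := hM p q h
      linarith [hq p]
  obtain ⟨q₀, hq₀⟩ := hstart
  -- Without degeneracy L_k sends a to a multiple of b alone, so L_k M = M L_k on the column a
  -- forces M to kill b as well.
  have hstep : ∀ a b, (∀ p, M p a = 0) → (∃ k, l k b a ≠ 0) → ∀ p, M p b = 0 := by
    rintro a b ha ⟨k, hk⟩ p
    have h1 : (l k * M) p a = (M * l k) p a := by
      have := congrFun (congrFun (hc k) p) a
      exact sub_eq_zero.1 this
    rw [Matrix.mul_apply, Matrix.mul_apply] at h1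
    simp only [ha, mul_zero, Finset.sum_const_zero] at h1
    rw [Finset.sum_eq_single b] at h1
    · exact (mul_eq_zero.1 h1.symm).resolve_right hk
    · intro c _ hcb
      by_cases h : l k c a = 0
      · rw [h, mul_zero]
      · exact absurd (hε (by linarith [hj k a c h, hj k a b hk])) hcb
    · simp
  ext p q
  have : ∀ n, Relation.ReflTransGen (fun a b => ∃ k, l k b a ≠ 0) q₀ n → ∀ p, M p n = 0 := by
    intro n hn
    induction hn with
    | refl => exact hq₀
    | tail _ h ih => exact hstep _ _ ih h
  exact this q (hirr q₀ q) p

/-- Two levels that reach the same n with the same energy change have equal energy. Thus L†L is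
diagonal and the anticommutator acts entrywise. -/
theorem conjTranspose_mul_self_apply_of_ne (hε : Function.Injective ε)
    (hj : ∀ k m n, l k n m ≠ 0 → ε m - ε n = ω k) (k : ι) {a b : Fin d} (hab : a ≠ b) :
    ((l k)ᴴ * l k) a b = 0 := by
  rw [Matrix.mul_apply]
  refine Finset.sum_eq_zero fun n _ => ?_
  by_contra h
  rw [Matrix.conjTranspose_apply] at h
  have h1 : l k n a ≠ 0 := fun h' => h (by rw [h']; simp)
  have h2 : l k n b ≠ 0 := fun h' => h (by rw [h']; simp)
  exact hab (hε (by linarith [hj k a n h1, hj k b n h2]))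

theorem conjTranspose_mul_self_apply_self (A : Op d) (a : Fin d) :
    (Aᴴ * A) a a = ((∑ n, ‖A n a‖ ^ 2 : ℝ) : ℂ) := by
  rw [Matrix.mul_apply]
  push_cast
  refine Finset.sum_congr rfl fun n _ => ?_
  rw [Matrix.conjTranspose_apply, Complex.star_def, ← Complex.normSq_eq_conj_mul_self,
    Complex.normSq_eq_norm_sq]
  push_cast; rfl

theorem adjDissipator_apply (hε : Function.Injective ε)
    (hj : ∀ k m n, l k n m ≠ 0 → ε m - ε n = ω k) (k : ι) (M : Op d) (a b : Fin d) :
    adjDissipator (l k) M a b = ∑ c : Fin d × Fin d, star (l k c.1 a) * M c.1 c.2 * l k c.2 b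
      - (1 / 2 : ℂ) * ((∑ n, (‖l k n a‖ ^ 2 + ‖l k n b‖ ^ 2) : ℝ) : ℂ) * M a b := by
  have h1 : ((l k)ᴴ * M * l k) a b
      = ∑ c : Fin d × Fin d, star (l k c.1 a) * M c.1 c.2 * l k c.2 b := by
    rw [Fintype.sum_prod_type, Finset.sum_comm, Matrix.mul_apply]
    refine Finset.sum_congr rfl fun q _ => ?_
    rw [Matrix.mul_apply, Finset.sum_mul]
    rfl
  have h2 : ((l k)ᴴ * l k * M) a b = ((∑ n, ‖l k n a‖ ^ 2 : ℝ) : ℂ) * M a b := by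
    rw [Matrix.mul_apply, Finset.sum_eq_single a, conjTranspose_mul_self_apply_self]
    · intro c _ hc
      rw [conjTranspose_mul_self_apply_of_ne hε hj k hc.symm, zero_mul]
    · simp
  have h3 : (M * ((l k)ᴴ * l k)) a b = ((∑ n, ‖l k n b‖ ^ 2 : ℝ) : ℂ) * M a b := by
    rw [Matrix.mul_apply, Finset.sum_eq_single b, conjTranspose_mul_self_apply_self, mul_comm]
    · intro c _ hc
      rw [conjTranspose_mul_self_apply_of_ne hε hj k hc, mul_zero]
    · simp
  rw [adjDissipator, Matrix.sub_apply, h1, Matrix.smul_apply, Matrix.add_apply, h2, h3,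
    Finset.sum_add_distrib, smul_eq_mul]
  push_cast
  ring

/-- From a single level one jump operator reaches only one level, so diagonal entries of D†M see
only diagonal entries of M. -/
theorem sum_adjDissipator_apply_self [Fintype ι] (hε : Function.Injective ε)
    (hj : ∀ k m n, l k n m ≠ 0 → ε m - ε n = ω k) {M : Op d} (hM : ∀ a, M a a = 0) (a : Fin d) :
    (∑ k, adjDissipator (l k) M) a a = 0 := by
  rw [Matrix.sum_apply]
  refine Finset.sum_eq_zero fun k _ => ?_
  rw [adjDissipator_apply hε hj, hM, mul_zero, sub_zero]
  refine Finset.sum_eq_zero fun c _ => ?_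
  by_contra h
  have h1 : l k c.1 a ≠ 0 := fun h' => h (by rw [h']; simp)
  have h2 : l k c.2 a ≠ 0 := fun h' => h (by rw [h']; simp)
  have h3 : c.1 = c.2 := hε (by linarith [hj k a _ h1, hj k a _ h2])
  rw [h3, hM] at h
  simp at h

end Jumps

end

section

variable {d : ℕ} {ι : Type*} [Fintype ι]

/-! ### The phase function. -/

theorem star_phase_mul_star (x : ℂ) : star (phase x) * star x = (‖x‖ : ℂ) := by
  by_cases h : x = 0
  · simp [h, phase]
  · rw [phase, if_neg h, star_div₀, star_star, Complex.star_def,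
      Complex.conj_ofReal, div_mul_eq_mul_div, Complex.mul_conj, Complex.normSq_eq_norm_sq]
    have : (‖x‖ : ℂ) ≠ 0 := by simpa using h
    push_cast
    field_simp

theorem phase_star (x : ℂ) : phase (star x) = star (phase x) := by
  by_cases h : x = 0
  · simp [h, phase]
  · have h' : star x ≠ 0 := by simpa using h
    rw [phase, phase, if_neg h, if_neg h', star_div₀, norm_star, Complex.star_def,
      Complex.conj_ofReal]

theorem norm_phase (x : ℂ) : ‖phase x‖ = 1 := by
  by_cases h : x = 0
  · simp [h, phase]
  · rw [phase, if_neg h, norm_div, norm_star, Complex.norm_real, norm_norm,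
      div_self (norm_ne_zero_iff.2 h)]

/-! ### The gap-class blocks and the operator they determine. -/

section Blocks

variable {V : Op d} {L : ι → Op d} {ε : Fin d → ℝ} {ω : ι → ℝ}

/-- The action of the dissipator on coherences is given by the coefficients `γ`. -/
theorem sum_gammaCoeff_mul_star (hε : Function.Injective ε)
    (hj : ∀ k m n, rep V (L k) n m ≠ 0 → ε m - ε n = ω k) (h0 : ∀ k n, rep V (L k) n n = 0)
    {M : Op d} (hM : ∀ a, M a a = 0) {a b : Fin d} (hab : a ≠ b) {g : ℝ} (hg : ε a - ε b = g) :
    ∑ c : GapClass ε g, gammaCoeff V L (a, b) c.1 * star (M c.1.1 c.1.2)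
      = -2 * star ((∑ k, adjDissipator (rep V (L k)) M) a b) := by
  set F : Fin d × Fin d → ℂ := fun c =>
    ∑ k, rep V (L k) c.1 a * star (M c.1 c.2) * star (rep V (L k) c.2 b) with hF
  set D : ℂ := ((∑ k, ∑ n, (‖rep V (L k) n a‖ ^ 2 + ‖rep V (L k) n b‖ ^ 2) : ℝ) : ℂ) with hD
  -- Jumps have no diagonal entries, so the off-diagonal formula for γ would contribute nothing at
  -- (a, b), and the case distinction in its definition is harmless.
  have hFab : F (a, b) = 0 := by simp [hF, h0]
  have hterm : ∀ c : Fin d × Fin d, gammaCoeff V L (a, b) c * star (M c.1 c.2)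
      = -2 * F c + if (a, b) = c then D * star (M a b) else 0 := by
    intro c
    by_cases h : (a, b) = c
    · subst h
      rw [gammaCoeff, if_pos rfl, if_pos rfl, hFab]
      simp [hD]
    · rw [gammaCoeff, if_neg h, if_neg h, add_zero, hF]
      simp only [rep_conjTranspose, Matrix.conjTranspose_apply]
      rw [mul_assoc, Finset.sum_mul]
      congr 1
      exact Finset.sum_congr rfl fun k _ => by ring
  -- A jump changes both energies by the same ω, so only pairs with the gap of (a, b) contribute;
  -- pairs p = q are excluded by the zero diagonal of M.
  have hFsum : ∑ c : GapClass ε g, F c.1 = ∑ c, F c := by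
    rw [← Finset.sum_subtype (Finset.univ.filter fun p : Fin d × Fin d =>
      p.1 ≠ p.2 ∧ ε p.1 - ε p.2 = g) (by simp) F]
    refine Finset.sum_filter_of_ne fun c _ hc => ?_
    obtain ⟨k, -, hk⟩ := Finset.exists_ne_zero_of_sum_ne_zero hc
    have h1 : rep V (L k) c.1 a ≠ 0 := fun h' => hk (by rw [h']; simp)
    have h2 : rep V (L k) c.2 b ≠ 0 := fun h' => hk (by rw [h']; simp)
    have h3 : M c.1 c.2 ≠ 0 := fun h' => hk (by rw [h']; simp)
    refine ⟨fun h => h3 (by rw [h, hM]), ?_⟩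
    linarith [hj k _ _ h1, hj k _ _ h2]
  have hR : star ((∑ k, adjDissipator (rep V (L k)) M) a b)
      = ∑ c, F c - (1 / 2 : ℂ) * D * star (M a b) := by
    rw [Matrix.sum_apply, star_sum]
    have : ∀ k, star (adjDissipator (rep V (L k)) M a b)
        = ∑ c : Fin d × Fin d, rep V (L k) c.1 a * star (M c.1 c.2) * star (rep V (L k) c.2 b)
          - (1 / 2 : ℂ) * ((∑ n, (‖rep V (L k) n a‖ ^ 2 + ‖rep V (L k) n b‖ ^ 2) : ℝ) : ℂ)
            * star (M a b) := by
      intro k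
      rw [adjDissipator_apply (l := fun k => rep V (L k)) hε hj, star_sub, star_sum]
      congr 1
      · exact Finset.sum_congr rfl fun c _ => by simp
      · have h2 : star (1 / 2 : ℂ) = 1 / 2 := by
          have := Complex.conj_ofReal (1 / 2)
          push_cast at this
          exact this
        rw [star_mul', star_mul', h2, Complex.star_def, Complex.conj_ofReal]
    simp only [this, Finset.sum_sub_distrib]
    rw [Finset.sum_comm, hD, Complex.ofReal_sum, Finset.mul_sum, Finset.sum_mul]
  simp only [hterm, Finset.sum_add_distrib, ← Finset.mul_sum]
  rw [hFsum, hR, Finset.sum_eq_single (⟨(a, b), hab, hg⟩ : GapClass ε g)]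
  · simp; ring
  · intro c _ hc
    rw [if_neg]
    rintro h
    exact hc (Subtype.ext h.symm)
  · simp

/-- A kernel vector, conjugated and extended by zero, is a matrix M supported on one class with D†M
= 0. It then commutes with every jump and, shifting energy by g, must vanish. -/
theorem isUnit_gammaBlock {β : ℝ} {rev : ι → ι} (hrev : Function.Involutive rev)
    (hdb : ∀ k, rep V (L k) = (Real.exp (β * ω k / 2) : ℂ) • (rep V (L (rev k)))ᴴ)
    (hε : Function.Injective ε)
    (hj : ∀ k m n, rep V (L k) n m ≠ 0 → ε m - ε n = ω k) (h0 : ∀ k n, rep V (L k) n n = 0)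
    (hirr : IsIrreducible V L) (g : ℝ) : IsUnit (gammaBlock V ε L g) := by
  classical
  rw [← Matrix.mulVec_injective_iff_isUnit]
  refine (injective_iff_map_eq_zero (gammaBlock V ε L g).mulVecLin).2 fun x hx => ?_
  set M : Op d := Matrix.of fun p q =>
    if h : p ≠ q ∧ ε p - ε q = g then star (x ⟨(p, q), h⟩) else 0 with hMdef
  have hMc : ∀ c : GapClass ε g, star (M c.1.1 c.1.2) = x c := by
    rintro ⟨⟨p, q⟩, h⟩
    simp [hMdef, h]
  have hM0 : ∀ a, M a a = 0 := fun a => by simp [hMdef]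
  have hMg : ∀ p q, M p q ≠ 0 → p ≠ q ∧ ε p - ε q = g := by
    intro p q h
    by_contra h'
    exact h (by simp [hMdef, h'])
  have hadj : ∑ k, adjDissipator (rep V (L k)) M = 0 := by
    ext a b
    by_cases hab : a = b
    · subst hab
      exact sum_adjDissipator_apply_self (l := fun k => rep V (L k)) hε hj hM0 a
    · have key := sum_gammaCoeff_mul_star hε hj h0 hM0 hab rfl
      have hz : ∑ c : GapClass ε (ε a - ε b), gammaCoeff V L (a, b) c.1 * star (M c.1.1 c.1.2)
          = 0 := by
        by_cases hg : ε a - ε b = g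
        · subst hg
          simp only [hMc]
          exact congrFun hx ⟨(a, b), hab, rfl⟩
        · refine Finset.sum_eq_zero fun c _ => ?_
          have : M c.1.1 c.1.2 = 0 := by
            by_contra h
            exact hg (c.2.2.symm.trans (hMg _ _ h).2)
          rw [this]; simp
      rw [hz] at key
      simpa using key.symm
  have hcomm := opComm_eq_zero_of_adjDissipator (l := fun k => rep V (L k)) hrev hdb hj hadj
  -- For g = 0 the class is empty, the levels being distinct.
  by_cases hg : g = 0
  · ext c
    exact absurd (hε (by linarith [c.2.2])) c.2.1
  · have hMz := eq_zero_of_opComm_eq_zero (l := fun k => rep V (L k)) hε hj hirr hg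
      (fun p q h => (hMg p q h).2) hcomm
    ext c
    rw [← hMc c, hMz]
    simp

theorem eq_zero_of_sum_adjDissipator (hε : Function.Injective ε)
    (hj : ∀ k m n, rep V (L k) n m ≠ 0 → ε m - ε n = ω k) (h0 : ∀ k n, rep V (L k) n n = 0)
    (hunit : ∀ g, IsUnit (gammaBlock V ε L g)) {M : Op d} (hM : ∀ a, M a a = 0)
    (hadj : ∑ k, adjDissipator (rep V (L k)) M = 0) : M = 0 := by
  have key : ∀ g, (fun c : GapClass ε g => star (M c.1.1 c.1.2)) = 0 := by
    intro g
    refine Matrix.mulVec_injective_iff_isUnit.2 (hunit g) ?_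
    rw [Matrix.mulVec_zero]
    ext c
    have h := sum_gammaCoeff_mul_star hε hj h0 hM c.2.1 c.2.2
    rw [hadj] at h
    simpa [Matrix.mulVec, dotProduct, gammaBlock] using h
  ext a b
  by_cases hab : a = b
  · subst hab; exact hM a
  · have := congrFun (key (ε a - ε b)) ⟨(a, b), hab, rfl⟩
    simpa using this

/-- The matrix of `X` in the energy eigenbasis. -/
def zMatrix (V : Op d) (ε : Fin d → ℝ) (L : ι → Op d) (ρ : Op d) : Op d :=
  Matrix.of fun p q => star (zCoeff V ε L ρ p q)

theorem zMatrix_apply_self (ρ : Op d) (a : Fin d) : zMatrix V ε L ρ a a = 0 := by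
  simp [zMatrix, zCoeff]

theorem star_zMatrix_gapClass (ρ : Op d) {g : ℝ} (c : GapClass ε g) :
    star (zMatrix V ε L ρ c.1.1 c.1.2)
      = ((gammaBlock V ε L g)⁻¹ *ᵥ fun r => phase (rep V ρ r.1.1 r.1.2)) c := by
  obtain ⟨⟨p, q⟩, h, hg⟩ := c
  dsimp only at h hg
  subst hg
  simp [zMatrix, zCoeff, h]

/-- This is the defining system for z read in operator form: the factor −½ undoes the −2 relating γ
to D†. -/
theorem sum_adjDissipator_zMatrix (hε : Function.Injective ε)
    (hj : ∀ k m n, rep V (L k) n m ≠ 0 → ε m - ε n = ω k) (h0 : ∀ k n, rep V (L k) n n = 0)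
    (hunit : ∀ g, IsUnit (gammaBlock V ε L g)) (ρ : Op d) {a b : Fin d} (hab : a ≠ b) :
    (∑ k, adjDissipator (rep V (L k)) (zMatrix V ε L ρ)) a b
      = -(1 / 2 : ℂ) * star (phase (rep V ρ a b)) := by
  have h := sum_gammaCoeff_mul_star hε hj h0 (zMatrix_apply_self (V := V) (L := L) (ε := ε) ρ)
    hab rfl
  simp only [star_zMatrix_gapClass] at h
  have hdet : IsUnit (gammaBlock V ε L (ε a - ε b)).det :=
    (Matrix.isUnit_iff_isUnit_det _).1 (hunit _)
  have h2 : (gammaBlock V ε L (ε a - ε b) *ᵥ ((gammaBlock V ε L (ε a - ε b))⁻¹ *ᵥ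
      fun r => phase (rep V ρ r.1.1 r.1.2))) ⟨(a, b), hab, rfl⟩ = phase (rep V ρ a b) := by
    rw [Matrix.mulVec_mulVec, Matrix.mul_nonsing_inv _ hdet, Matrix.one_mulVec]
  have h3 : phase (rep V ρ a b)
      = -2 * star ((∑ k, adjDissipator (rep V (L k)) (zMatrix V ε L ρ)) a b) := by
    rw [← h2, ← h]
    rfl
  rw [h3]
  simp

/-- The prescribed values of D†X form a Hermitian matrix because c_ba is the conjugate of c_ab;
hence X† − X lies in the trivial kernel. -/
theorem zMatrix_isHermitian (hε : Function.Injective ε)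
    (hj : ∀ k m n, rep V (L k) n m ≠ 0 → ε m - ε n = ω k) (h0 : ∀ k n, rep V (L k) n n = 0)
    (hunit : ∀ g, IsUnit (gammaBlock V ε L g)) {ρ : Op d} (hρ : ρ.IsHermitian) :
    (zMatrix V ε L ρ).IsHermitian := by
  set M := zMatrix V ε L ρ with hM
  have hM0 : ∀ a, M a a = 0 := zMatrix_apply_self ρ
  have hN0 : ∀ a, (Mᴴ - M) a a = 0 := fun a => by simp [hM0]
  refine sub_eq_zero.1 (eq_zero_of_sum_adjDissipator hε hj h0 hunit hN0 ?_)
  ext a b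
  by_cases hab : a = b
  · subst hab
    exact sum_adjDissipator_apply_self (l := fun k => rep V (L k)) hε hj hN0 a
  · simp only [adjDissipator_sub, Finset.sum_sub_distrib, adjDissipator_conjTranspose]
    rw [← Matrix.conjTranspose_sum, Matrix.sub_apply, Matrix.conjTranspose_apply,
      sum_adjDissipator_zMatrix hε hj h0 hunit ρ hab,
      sum_adjDissipator_zMatrix hε hj h0 hunit ρ (Ne.symm hab),
      ← (rep_isHermitian V hρ).apply a b, phase_star]
    simp

theorem trace_mul_sum_dissipator (M σ : Op d) (l : ι → Op d) :
    (M * ∑ k, dissipator (l k) σ).trace = ((∑ k, adjDissipator (l k) M) * σ).trace := by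
  rw [Finset.mul_sum, Finset.sum_mul, Matrix.trace_sum, Matrix.trace_sum]
  exact Finset.sum_congr rfl fun k _ => trace_mul_dissipator _ _ _

theorem re_trace_zMatrix_mul (hε : Function.Injective ε)
    (hj : ∀ k m n, rep V (L k) n m ≠ 0 → ε m - ε n = ω k) (h0 : ∀ k n, rep V (L k) n n = 0)
    (hunit : ∀ g, IsUnit (gammaBlock V ε L g)) (ρ σ : Op d) :
    ((zMatrix V ε L ρ * ∑ k, dissipator (rep V (L k)) σ).trace).re
      = -(1 / 2) * ∑ a, ∑ b, if a = b then 0 else (star (phase (rep V ρ a b)) * σ b a).re := by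
  rw [trace_mul_sum_dissipator, Matrix.trace, Complex.re_sum, Finset.mul_sum]
  refine Finset.sum_congr rfl fun a _ => ?_
  rw [Matrix.diag_apply, Matrix.mul_apply, Complex.re_sum, Finset.mul_sum]
  refine Finset.sum_congr rfl fun b _ => ?_
  by_cases hab : a = b
  · subst hab
    rw [sum_adjDissipator_apply_self (l := fun k => rep V (L k)) hε hj (zMatrix_apply_self ρ)]
    simp
  · rw [sum_adjDissipator_zMatrix hε hj h0 hunit ρ hab, if_neg hab]
    have : -(1 / 2 : ℂ) * star (phase (rep V ρ a b)) * σ b a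
        = ((-(1 / 2) : ℝ) : ℂ) * (star (phase (rep V ρ a b)) * σ b a) := by push_cast; ring
    rw [this, Complex.re_ofReal_mul]

/-! Norm bounds for `X`. -/

/-- An off-diagonal entry of D†X has modulus ½, and d ≥ 2 provides one. As ‖D†X‖ is at most Σ
‖L_k‖‖[L_k, X]‖, Cauchy–Schwarz over k bounds the commutators from below, uniformly in time. -/
theorem one_le_sum_norm_sq_opComm (hε : Function.Injective ε)
    (hj : ∀ k m n, rep V (L k) n m ≠ 0 → ε m - ε n = ω k) (h0 : ∀ k n, rep V (L k) n n = 0)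
    (hunit : ∀ g, IsUnit (gammaBlock V ε L g)) {ρ : Op d} (hρ : ρ.IsHermitian) (hd : 2 ≤ d) {B : ℝ}
    (hB : ∀ k, ‖rep V (L k)‖ ≤ B) :
    1 ≤ 4 * B ^ 2 * Fintype.card ι * ∑ k, ‖opComm (rep V (L k)) (zMatrix V ε L ρ)‖ ^ 2 := by
  set M := zMatrix V ε L ρ with hM
  have hMh : M.IsHermitian := zMatrix_isHermitian hε hj h0 hunit hρ
  have hab : (⟨0, by omega⟩ : Fin d) ≠ ⟨1, by omega⟩ := by simp
  have h1 := norm_apply_le (∑ k, adjDissipator (rep V (L k)) M) ⟨0, by omega⟩ ⟨1, by omega⟩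
  rw [sum_adjDissipator_zMatrix hε hj h0 hunit ρ hab, norm_mul, norm_star, norm_phase] at h1
  have h2 : ‖(-(1 / 2) : ℂ)‖ = 1 / 2 := by simp
  rw [h2, mul_one] at h1
  have h3 : ‖∑ k, adjDissipator (rep V (L k)) M‖ ≤ ∑ k, B * ‖opComm (rep V (L k)) M‖ :=
    norm_sum_le_of_le _ fun k _ => (norm_adjDissipator_le _ hMh).trans
      (mul_le_mul_of_nonneg_right (hB k) (norm_nonneg _))
  rw [← Finset.mul_sum] at h3
  set S := ∑ k, ‖opComm (rep V (L k)) M‖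
  have h4 : S ^ 2 ≤ Fintype.card ι * ∑ k, ‖opComm (rep V (L k)) M‖ ^ 2 := by
    have := sq_sum_le_card_mul_sum_sq (s := Finset.univ) (f := fun k => ‖opComm (rep V (L k)) M‖)
    simpa using this
  have h5 : (1 / 2 : ℝ) ≤ B * S := h1.trans h3
  have h6 : (1 / 2 : ℝ) ^ 2 ≤ (B * S) ^ 2 := pow_le_pow_left₀ (by norm_num) h5 2
  have h7 := mul_le_mul_of_nonneg_left h4 (sq_nonneg B)
  nlinarith

theorem norm_sq_le_sum_norm_sq (A : Op d) : ‖A‖ ^ 2 ≤ ∑ p, ∑ q, ‖A p q‖ ^ 2 := by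
  have h0 : 0 ≤ ∑ p, ∑ q, ‖A p q‖ ^ 2 :=
    Finset.sum_nonneg fun _ _ => Finset.sum_nonneg fun _ _ => sq_nonneg _
  refine (Real.le_sqrt (norm_nonneg _) h0).1 ?_
  rw [Matrix.cstar_norm_def]
  refine ContinuousLinearMap.opNorm_le_bound _ (Real.sqrt_nonneg _) fun x => ?_
  refine le_of_sq_le_sq ?_ (by positivity)
  rw [mul_pow, Real.sq_sqrt h0, EuclideanSpace.norm_sq_eq, EuclideanSpace.norm_sq_eq,
    Finset.sum_mul]
  refine Finset.sum_le_sum fun p _ => ?_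
  rw [Matrix.ofLp_toEuclideanCLM, Matrix.mulVec, dotProduct]
  calc ‖∑ q, A p q * x q‖ ^ 2 ≤ (∑ q, ‖A p q‖ * ‖x q‖) ^ 2 := by
        gcongr
        exact norm_sum_le_of_le _ fun q _ => (norm_mul _ _).le
    _ ≤ _ := Finset.sum_mul_sq_le_sq_mul_sq _ _ _

theorem sum_gapClass_norm_sq_le (ρ : Op d) (g : ℝ) :
    ∑ c : GapClass ε g, ‖zMatrix V ε L ρ c.1.1 c.1.2‖ ^ 2
      ≤ ‖(gammaBlock V ε L g)⁻¹‖ ^ 2 * Fintype.card (GapClass ε g) := by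
  have h := (gammaBlock V ε L g)⁻¹.l2_opNorm_mulVec
    (WithLp.toLp 2 fun r => phase (rep V ρ r.1.1 r.1.2))
  have h2 := pow_le_pow_left₀ (norm_nonneg _) h 2
  rw [mul_pow, EuclideanSpace.norm_sq_eq, EuclideanSpace.norm_sq_eq] at h2
  simp only [norm_phase, one_pow, Finset.sum_const, Finset.card_univ, nsmul_eq_mul, mul_one] at h2
  refine le_trans (le_of_eq ?_) h2
  refine Finset.sum_congr rfl fun c _ => ?_
  rw [← norm_star, star_zMatrix_gapClass]
  rfl

/-- The squared Frobenius norm is summed class by class. The right side of each linear system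
consists of phases, so its squared length is the class size, and the sizes add up to d(d − 1). -/
theorem norm_sq_zMatrix_le (ρ : Op d) :
    ‖zMatrix V ε L ρ‖ ^ 2 ≤ d * (d - 1) * maxInvNormSq V ε L := by
  classical
  refine (norm_sq_le_sum_norm_sq _).trans ?_
  set f : Fin d × Fin d → ℝ := fun c => ‖zMatrix V ε L ρ c.1 c.2‖ ^ 2 with hf
  set s : Finset (Fin d × Fin d) := Finset.univ.offDiag with hs
  set gap : Fin d × Fin d → ℝ := fun c => ε c.1 - ε c.2 with hgap
  have h1 : ∑ p, ∑ q, ‖zMatrix V ε L ρ p q‖ ^ 2 = ∑ c ∈ s, f c := by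
    rw [← Fintype.sum_prod_type']
    refine (Finset.sum_subset (Finset.subset_univ s) fun c _ hc => ?_).symm
    have : c.1 = c.2 := by simpa [hs] using hc
    rw [this, zMatrix_apply_self]; simp
  have hcard : (s.card : ℝ) = d * (d - 1) := by
    rw [hs, Finset.offDiag_card, Finset.card_univ, Fintype.card_fin,
      Nat.cast_sub (Nat.le_mul_self d)]
    push_cast; ring
  have hfib : ∀ g ∈ s.image gap, ∑ c ∈ s with gap c = g, f c
      ≤ maxInvNormSq V ε L * (s.filter fun c => gap c = g).card := by
    intro g hg
    obtain ⟨c₀, hc₀, rfl⟩ := Finset.mem_image.1 hg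
    have hmem : ∀ c, c ∈ s.filter (fun c => gap c = gap c₀) ↔
        c.1 ≠ c.2 ∧ ε c.1 - ε c.2 = gap c₀ := fun c => by simp [hs, hgap]
    rw [Finset.sum_subtype _ hmem f]
    have hc : (s.filter fun c => gap c = gap c₀).card = Fintype.card (GapClass ε (gap c₀)) :=
      (Fintype.card_of_subtype _ hmem).symm
    rw [hc]
    refine (sum_gapClass_norm_sq_le ρ (gap c₀)).trans ?_
    refine mul_le_mul_of_nonneg_right ?_ (Nat.cast_nonneg _)
    have hne : c₀.1 ≠ c₀.2 := by simpa [hs] using hc₀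
    exact le_ciSup (f := fun i : {p : Fin d × Fin d // p.1 ≠ p.2} =>
      ‖(gammaBlock V ε L (ε i.1.1 - ε i.1.2))⁻¹‖ ^ 2) (Set.finite_range _).bddAbove ⟨c₀, hne⟩
  rw [h1, ← Finset.sum_fiberwise_of_maps_to (g := gap) fun c hc => Finset.mem_image_of_mem gap hc]
  refine (Finset.sum_le_sum hfib).trans (le_of_eq ?_)
  rw [← Finset.mul_sum, ← hcard, mul_comm]
  congr 1
  rw [Finset.card_eq_sum_card_image gap s]
  push_cast; rfl

theorem sum_norm_sq_opComm_zMatrix_le (ρ : Op d) :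
    ∑ k, ‖opComm (rep V (L k)) (zMatrix V ε L ρ)‖ ^ 2
      ≤ 4 * d * (d - 1) * ((∑ k, ‖rep V (L k)‖ ^ 2) * maxInvNormSq V ε L) := by
  have h := norm_sq_zMatrix_le (V := V) (ε := ε) (L := L) ρ
  calc ∑ k, ‖opComm (rep V (L k)) (zMatrix V ε L ρ)‖ ^ 2
      ≤ ∑ k, 4 * ‖rep V (L k)‖ ^ 2 * (d * (d - 1) * maxInvNormSq V ε L) := by
        refine Finset.sum_le_sum fun k _ => ?_
        have h1 := pow_le_pow_left₀ (norm_nonneg _)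
          (norm_opComm_le (rep V (L k)) (zMatrix V ε L ρ)) 2
        have h2 := mul_le_mul_of_nonneg_left h (by positivity : 0 ≤ 4 * ‖rep V (L k)‖ ^ 2)
        nlinarith
    _ = _ := by
        rw [← Finset.sum_mul, ← Finset.mul_sum]; ring

end Blocks

end

section

/-! Passing between `X` and its matrix in the energy eigenbasis. -/

section Common

variable {d : ℕ} {ι : Type*} [Fintype ι]

theorem ofRep_isHermitian (V : Op d) {M : Op d} (hM : M.IsHermitian) :
    (ofRep V M).IsHermitian := by
  rw [Matrix.IsHermitian, ofRep]
  simp [Matrix.conjTranspose_mul, hM.eq, mul_assoc]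

theorem ofRep_interaction (U V M : Op d) :
    ofRep (Uᴴ * V) M = interaction U (ofRep V M) := by
  simp [ofRep, interaction, Matrix.conjTranspose_mul, mul_assoc]

theorem interaction_isHermitian (U : Op d) {A : Op d} (hA : A.IsHermitian) :
    (interaction U A).IsHermitian :=
  rep_isHermitian U hA

theorem norm_opComm_ofRep {V : Op d} (hV : V ∈ Matrix.unitaryGroup (Fin d) ℂ) (A M : Op d) :
    ‖opComm A (ofRep V M)‖ = ‖opComm (rep V A) M‖ := by
  rw [← norm_rep hV, rep_opComm hV, rep_ofRep hV]

theorem trace_ofRep_mul_dissipator {V : Op d} (hV : V ∈ Matrix.unitaryGroup (Fin d) ℂ)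
    (M σ : Op d) (L : ι → Op d) :
    (ofRep V M * ∑ k, dissipator (L k) σ).trace
      = (M * ∑ k, dissipator (rep V (L k)) (rep V σ)).trace := by
  rw [← trace_rep hV, rep_mul hV, rep_ofRep hV, rep_sum]
  simp only [rep_dissipator hV]

/-- An operator whose expectation decays at half the rate given by the coherence. -/
theorem detects_coherence {V ρ M : Op d} {L : ι → Op d}
    (hV : V ∈ Matrix.unitaryGroup (Fin d) ℂ) (hρ : ρ.IsHermitian)
    (h : ∀ σ : Op d, ((M * ∑ k, dissipator (rep V (L k)) σ).trace).re
      = -(1 / 2) * ∑ a, ∑ b, if a = b then 0 else (star (phase (rep V ρ a b)) * σ b a).re) :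
    ((ofRep V M * ∑ k, dissipator (L k) 1).trace).re = 0 ∧
    coherenceL1 V ρ = -2 * ((ofRep V M * ∑ k, dissipator (L k) ρ).trace).re := by
  constructor
  · rw [trace_ofRep_mul_dissipator hV, rep_one hV, h]
    rw [Finset.sum_eq_zero, mul_zero]
    refine fun a _ => Finset.sum_eq_zero fun b _ => ?_
    by_cases hab : a = b
    · simp [hab]
    · rw [if_neg hab, Matrix.one_apply_ne (Ne.symm hab)]
      simp
  · rw [trace_ofRep_mul_dissipator hV, h, coherenceL1]
    have : ∀ a b, (star (phase (rep V ρ a b)) * rep V ρ b a).re = ‖rep V ρ a b‖ := by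
      intro a b
      rw [← (rep_isHermitian V hρ).apply b a, star_phase_mul_star, Complex.ofReal_re]
    simp only [this]
    ring

end Common

/-! The qubit. -/

section Qubit

variable {γ₁ γ₂ : ℝ}

/-- The matrix of the qubit operator `X` in the energy eigenbasis, with phase `u`. -/
def qubitMatrix (γ₁ γ₂ : ℝ) (u : ℂ) : Op 2 :=
  ((γ₁ + γ₂ : ℝ) : ℂ)⁻¹ • (u • Matrix.single 0 1 1 + star u • Matrix.single 1 0 1)

/-- The jump operators of the qubit in the energy eigenbasis. -/
def qubitJump (γ₁ γ₂ : ℝ) : Fin 2 → Op 2 :=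
  ![((Real.sqrt γ₁ : ℝ) : ℂ) • Matrix.single 0 1 1, ((Real.sqrt γ₂ : ℝ) : ℂ) • Matrix.single 1 0 1]

theorem qubitX_eq_ofRep {V U ρ : Op 2} (hρ : ρ.IsHermitian) :
    qubitX γ₁ γ₂ V U ρ
      = ofRep (Uᴴ * V) (qubitMatrix γ₁ γ₂ (star (phase (rep V ρ 0 1)))) := by
  have h : phase (rep V ρ 1 0) = star (phase (rep V ρ 0 1)) := by
    rw [← phase_star, (rep_isHermitian V hρ).apply 1 0]
  rw [qubitX, qubitMatrix, h]
  simp only [dyad, ofRep, Matrix.mul_smul, Matrix.smul_mul, mul_add, add_mul]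

theorem qubitMatrix_isHermitian (u : ℂ) : (qubitMatrix γ₁ γ₂ u).IsHermitian := by
  ext i j
  fin_cases i <;> fin_cases j <;> simp [qubitMatrix]

theorem ofReal_sqrt_mul_self {x : ℝ} (hx : 0 ≤ x) :
    ((Real.sqrt x : ℝ) : ℂ) * ((Real.sqrt x : ℝ) : ℂ) = (x : ℂ) := by
  rw [← Complex.ofReal_mul, Real.mul_self_sqrt hx]

/-- On qubit coherences D† is multiplication by −(γ₁ + γ₂)/2, which the prefactor of X reduces to
−½. -/
theorem sum_adjDissipator_qubitMatrix (h₁ : 0 < γ₁) (h₂ : 0 < γ₂) (u : ℂ) :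
    ∑ k, adjDissipator (qubitJump γ₁ γ₂ k) (qubitMatrix γ₁ γ₂ u)
      = -(1 / 2 : ℂ) • (u • Matrix.single 0 1 1 + star u • Matrix.single 1 0 1) := by
  have e₁ := ofReal_sqrt_mul_self h₁.le
  have e₂ := ofReal_sqrt_mul_self h₂.le
  have hγ : ((γ₁ : ℂ) + γ₂) ≠ 0 := by exact_mod_cast (add_pos h₁ h₂).ne'
  rw [Fin.sum_univ_two]
  ext i j
  fin_cases i <;> fin_cases j <;>
    simp [qubitJump, qubitMatrix, adjDissipator, Matrix.mul_apply, Matrix.single_apply]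
  · field_simp
    linear_combination (-u) * e₁ - u * e₂
  · field_simp
    linear_combination (-(starRingEnd ℂ) u) * e₁ - (starRingEnd ℂ) u * e₂

theorem re_trace_qubitMatrix_mul (h₁ : 0 < γ₁) (h₂ : 0 < γ₂) {A : Op 2} (hA : A.IsHermitian)
    (σ : Op 2) :
    ((qubitMatrix γ₁ γ₂ (star (phase (A 0 1))) *
      ∑ k, dissipator (qubitJump γ₁ γ₂ k) σ).trace).re
      = -(1 / 2) * ∑ a, ∑ b, if a = b then 0 else (star (phase (A a b)) * σ b a).re := by
  have h : phase (A 1 0) = star (phase (A 0 1)) := by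
    rw [← phase_star, hA.apply 1 0]
  have e : ∀ u : ℂ, ((-(1 / 2 : ℂ) • (u • (Matrix.single 0 1 1 : Op 2)
      + star u • Matrix.single 1 0 1)) * σ).trace
      = ((-(1 / 2) : ℝ) : ℂ) * (u * σ 1 0 + star u * σ 0 1) := by
    intro u
    simp [Matrix.trace_fin_two, Matrix.mul_apply, Matrix.single_apply]
    ring
  rw [trace_mul_sum_dissipator, sum_adjDissipator_qubitMatrix h₁ h₂, e, Complex.re_ofReal_mul,
    Complex.add_re]
  simp [Fin.sum_univ_two, h]
  ring

theorem norm_qubitJump_sq (h₁ : 0 < γ₁) (h₂ : 0 < γ₂) :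
    ‖qubitJump γ₁ γ₂ 0‖ ^ 2 = γ₁ ∧ ‖qubitJump γ₁ γ₂ 1‖ ^ 2 = γ₂ := by
  have key : ∀ i j : Fin 2, ‖(Matrix.single i j 1 : Op 2)‖ ^ 2 = 1 := by
    intro i j
    rw [sq, ← Matrix.l2_opNorm_conjTranspose_mul_self, Matrix.conjTranspose_single,
      Matrix.single_mul_single_same]
    simp only [star_one, mul_one]
    rw [← Matrix.diagonal_single, Matrix.l2_opNorm_diagonal, Pi.norm_single, norm_one]
  constructor
  · simp only [qubitJump, Matrix.cons_val_zero]
    rw [norm_smul, mul_pow, key, Complex.norm_real, Real.norm_eq_abs, sq_abs, Real.sq_sqrt h₁.le,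
      mul_one]
  · simp only [qubitJump, Matrix.cons_val_one, Matrix.cons_val_zero]
    rw [norm_smul, mul_pow, key, Complex.norm_real, Real.norm_eq_abs, sq_abs, Real.sq_sqrt h₂.le,
      mul_one]

/-- Both commutators are diagonal with entries of opposite sign and modulus √γᵢ/(γ₁ + γ₂), so the
spectral norms are exact. -/
theorem sum_norm_sq_opComm_qubit (h₁ : 0 < γ₁) (h₂ : 0 < γ₂) {u : ℂ} (hu : ‖u‖ = 1) :
    ∑ k, ‖opComm (qubitJump γ₁ γ₂ k) (qubitMatrix γ₁ γ₂ u)‖ ^ 2 = (γ₁ + γ₂)⁻¹ := by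
  have hγ : 0 < γ₁ + γ₂ := add_pos h₁ h₂
  have norm_diag : ∀ w : ℂ, ‖w‖ = 1 → ‖(Matrix.diagonal ![w, -w] : Op 2)‖ = 1 := by
    intro w hw
    rw [Matrix.l2_opNorm_diagonal]
    refine le_antisymm ((pi_norm_le_iff_of_nonneg zero_le_one).2 fun i => ?_) ?_
    · fin_cases i <;> simp [hw]
    · simpa [hw] using norm_le_pi_norm ![w, -w] 0
  have c0 : opComm (qubitJump γ₁ γ₂ 0) (qubitMatrix γ₁ γ₂ u)
      = ((Real.sqrt γ₁ * (γ₁ + γ₂)⁻¹ : ℝ) : ℂ) • Matrix.diagonal ![star u, -star u] := by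
    ext i j
    fin_cases i <;> fin_cases j <;>
      simp [qubitJump, qubitMatrix, opComm, Matrix.mul_apply, Matrix.single_apply] <;> ring
  have c1 : opComm (qubitJump γ₁ γ₂ 1) (qubitMatrix γ₁ γ₂ u)
      = ((Real.sqrt γ₂ * (γ₁ + γ₂)⁻¹ : ℝ) : ℂ) • Matrix.diagonal ![-u, - -u] := by
    ext i j
    fin_cases i <;> fin_cases j <;>
      simp [qubitJump, qubitMatrix, opComm, Matrix.mul_apply, Matrix.single_apply] <;> ring
  rw [Fin.sum_univ_two, c0, c1, norm_smul, norm_smul, norm_diag _ (by simpa using hu),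
    norm_diag _ (by simpa using hu), Complex.norm_real, Complex.norm_real, mul_one, mul_one,
    Real.norm_eq_abs, Real.norm_eq_abs, sq_abs, sq_abs, mul_pow, mul_pow, Real.sq_sqrt h₁.le,
    Real.sq_sqrt h₂.le]
  field_simp

end Qubit

theorem qubit_landauer {β τ : ℝ} (hβ : 0 < β) (hτ : 0 < τ) {H V U ρ : ℝ → Op 2}
    {ε : ℝ → Fin 2 → ℝ} {L : Fin 2 → ℝ → Op 2} {ω : Fin 2 → ℝ → ℝ} {rev : Fin 2 → Fin 2}
    {γ₁ γ₂ : ℝ → ℝ} (hT : IsThermalProtocol β τ H V ε L ω rev) (hρ : IsLindbladPath τ H L ρ)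
    (hU : IsPropagator τ H U) (hγ : ∀ t ∈ Icc 0 τ, 0 < γ₁ t ∧ 0 < γ₂ t)
    (hL₀ : ∀ t ∈ Icc 0 τ, L 0 t = ((Real.sqrt (γ₁ t) : ℝ) : ℂ) • dyad (V t) 0 1)
    (hL₁ : ∀ t ∈ Icc 0 τ, L 1 t = ((Real.sqrt (γ₂ t) : ℝ) : ℂ) • dyad (V t) 1 0) :
    let X : ℝ → Op 2 := fun t => qubitX (γ₁ t) (γ₂ t) (V t) (U t) (ρ t)
    (∀ t ∈ Icc 0 τ, (X t).IsHermitian) ∧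
    gammaR τ L U X ≠ ⊤ ∧
    (gammaR τ L U X)⁻¹ = (ENNReal.ofReal τ)⁻¹ *
      ∫⁻ t in Icc 0 τ, ENNReal.ofReal (totalRate fun k => L k t)⁻¹ ∧
    (gammaR τ L U X)⁻¹ = (ENNReal.ofReal τ)⁻¹ *
      ∫⁻ t in Icc 0 τ, ENNReal.ofReal (γ₁ t + γ₂ t)⁻¹ ∧
    β * heat τ H ρ ≥
      entropyDrop τ ρ + (gammaR τ L U X).toReal * coherence τ V ρ ^ 2 / (2 * τ) := by
  intro X
  set X₀ : ℝ → Op 2 := fun t =>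
    ofRep (V t) (qubitMatrix (γ₁ t) (γ₂ t) (star (phase (rep (V t) (ρ t) 0 1)))) with hX₀
  have hρh : ∀ t ∈ Icc 0 τ, (ρ t).IsHermitian := fun t ht => (hρ.density t ht).1.isHermitian
  have hXX₀ : ∀ t ∈ Icc 0 τ, X t = interaction (U t) (X₀ t) := fun t ht => by
    rw [hX₀, ← ofRep_interaction, ← qubitX_eq_ofRep (hρh t ht)]
  have hX₀h : ∀ t ∈ Icc 0 τ, (X₀ t).IsHermitian := fun t _ =>
    ofRep_isHermitian _ (qubitMatrix_isHermitian _)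
  have hUu : ∀ t ∈ Icc 0 τ, U t ∈ Matrix.unitaryGroup (Fin 2) ℂ := fun t ht =>
    hU.mem_unitaryGroup (fun t ht => hT.isHermitian ht) ht
  have hrep : ∀ t ∈ Icc 0 τ, ∀ k, rep (V t) (L k t) = qubitJump (γ₁ t) (γ₂ t) k := by
    intro t ht k
    fin_cases k
    · change rep (V t) (L 0 t) = _
      rw [hL₀ t ht, rep_smul, dyad, rep_ofRep (hT.unitary t ht)]
      rfl
    · change rep (V t) (L 1 t) = _
      rw [hL₁ t ht, rep_smul, dyad, rep_ofRep (hT.unitary t ht)]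
      rfl
  have hnorm : ∀ t ∈ Icc 0 τ, ‖L 0 t‖ ^ 2 = γ₁ t ∧ ‖L 1 t‖ ^ 2 = γ₂ t := by
    intro t ht
    have := norm_qubitJump_sq (hγ t ht).1 (hγ t ht).2
    rwa [← hrep t ht 0, ← hrep t ht 1, norm_rep (hT.unitary t ht), norm_rep (hT.unitary t ht)]
      at this
  have htotal : ∀ t ∈ Icc 0 τ, totalRate (fun k => L k t) = γ₁ t + γ₂ t := by
    intro t ht
    rw [totalRate, Fin.sum_univ_two, (hnorm t ht).1, (hnorm t ht).2]
  have hsum : ∀ t ∈ Icc 0 τ, ∑ k, ‖opComm (L k t) (X₀ t)‖ ^ 2 = (γ₁ t + γ₂ t)⁻¹ := by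
    intro t ht
    rw [← sum_norm_sq_opComm_qubit (hγ t ht).1 (hγ t ht).2
      (u := star (phase (rep (V t) (ρ t) 0 1))) (by rw [norm_star, norm_phase])]
    exact Finset.sum_congr rfl fun k _ => by
      rw [norm_opComm_ofRep (hT.unitary t ht), hrep t ht]
  have hdet : ∀ t ∈ Icc 0 τ, ((X₀ t * ∑ k, dissipator (L k t) 1).trace).re = 0 ∧
      coherenceL1 (V t) (ρ t) = -2 * ((X₀ t * ∑ k, dissipator (L k t) (ρ t)).trace).re := by
    intro t ht
    refine detects_coherence (hT.unitary t ht) (hρh t ht) fun σ => ?_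
    simp only [hrep t ht]
    exact re_trace_qubitMatrix_mul (hγ t ht).1 (hγ t ht).2 (rep_isHermitian _ (hρh t ht)) σ
  obtain ⟨B, hB⟩ := hT.bounded
  have h0 : (0 : ℝ) ∈ Icc 0 τ := ⟨le_rfl, hτ.le⟩
  -- Each rate is the squared norm of its jump operator, so boundedness of the jumps keeps 1/(γ₁ +
  -- γ₂) away from zero.
  have hle : ∀ t ∈ Icc 0 τ, γ₁ t + γ₂ t ≤ 2 * B ^ 2 := by
    intro t ht
    have b0 := pow_le_pow_left₀ (norm_nonneg _) ((hB t ht).2 0) 2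
    have b1 := pow_le_pow_left₀ (norm_nonneg _) ((hB t ht).2 1) 2
    rw [(hnorm t ht).1] at b0
    rw [(hnorm t ht).2] at b1
    linarith
  have hpos : ∀ t ∈ Icc 0 τ, 0 < γ₁ t + γ₂ t := fun t ht => add_pos (hγ t ht).1 (hγ t ht).2
  have hB0 : 0 < 2 * B ^ 2 := (hpos 0 h0).trans_le (hle 0 h0)
  have hne : gammaR τ L U X ≠ ⊤ := gammaR_ne_top hτ hUu hXX₀ (inv_pos.2 hB0) fun t ht => by
    rw [hsum t ht]
    exact inv_anti₀ (hpos t ht) (hle t ht)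
  have hval : (gammaR τ L U X)⁻¹ = (ENNReal.ofReal τ)⁻¹ *
      ∫⁻ t in Icc 0 τ, ENNReal.ofReal (γ₁ t + γ₂ t)⁻¹ := by
    rw [gammaR_interaction hUu hXX₀, inv_inv]
    congr 1
    exact setLIntegral_congr_fun measurableSet_Icc fun t ht => by simp only [hsum t ht]
  refine ⟨fun t ht => ?_, hne, ?_, hval, ?_⟩
  · rw [hXX₀ t ht]
    exact interaction_isHermitian _ (hX₀h t ht)
  · rw [hval]
    congr 1
    exact setLIntegral_congr_fun measurableSet_Icc fun t ht => by simp only [htotal t ht]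
  · exact heat_bound hβ hτ hT hρ hUu hXX₀ hX₀h (fun t ht => (hdet t ht).1)
      (fun t ht => (hdet t ht).2) hne

/-! The generic case. -/

theorem generic_landauer {d : ℕ} {ι : Type*} [Fintype ι] {β τ : ℝ} (hβ : 0 < β) (hτ : 0 < τ)
    {H V U ρ : ℝ → Op d} {ε : ℝ → Fin d → ℝ} {L : ι → ℝ → Op d} {ω : ι → ℝ → ℝ} {rev : ι → ι}
    (hd : 2 ≤ d) (hT : IsThermalProtocol β τ H V ε L ω rev) (hρ : IsLindbladPath τ H L ρ)
    (hU : IsPropagator τ H U) (hε : ∀ t ∈ Icc 0 τ, Function.Injective (ε t))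
    (hjump : ∀ k, ∀ t ∈ Icc 0 τ, IsJump (V t) (ε t) (L k t))
    (hirr : ∀ t ∈ Icc 0 τ, IsIrreducible (V t) fun k => L k t) :
    let X : ℝ → Op d := fun t => genericX (V t) (ε t) (fun k => L k t) (U t) (ρ t)
    (∀ t ∈ Icc 0 τ, ∀ g : ℝ, IsUnit (gammaBlock (V t) (ε t) (fun k => L k t) g)) ∧
    (∀ t ∈ Icc 0 τ, (X t).IsHermitian) ∧
    gammaR τ L U X ≠ ⊤ ∧
    β * heat τ H ρ ≥
      entropyDrop τ ρ + (gammaR τ L U X).toReal * coherence τ V ρ ^ 2 / (2 * τ) ∧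
    gammaR τ L U X ≥ ENNReal.ofReal τ / (4 * (d : ℝ≥0∞) * ((d : ℝ≥0∞) - 1) *
      ∫⁻ t in Icc 0 τ, ENNReal.ofReal ((totalRate fun k => L k t) *
        maxInvNormSq (V t) (ε t) (fun k => L k t))) := by
  intro X
  set M : ℝ → Op d := fun t => zMatrix (V t) (ε t) (fun k => L k t) (ρ t) with hM
  set X₀ : ℝ → Op d := fun t => ofRep (V t) (M t) with hX₀
  have hρh : ∀ t ∈ Icc 0 τ, (ρ t).IsHermitian := fun t ht => (hρ.density t ht).1.isHermitian
  have hXX₀ : ∀ t ∈ Icc 0 τ, X t = interaction (U t) (X₀ t) := fun t _ => by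
    rw [hX₀, ← ofRep_interaction]
    rfl
  have hUu : ∀ t ∈ Icc 0 τ, U t ∈ Matrix.unitaryGroup (Fin d) ℂ := fun t ht =>
    hU.mem_unitaryGroup (fun t ht => hT.isHermitian ht) ht
  -- In the energy basis the relation [L, H] = ωL reads (ε_m − ε_n) L_nm = ω L_nm.
  have hj : ∀ t ∈ Icc 0 τ, ∀ k m n, rep (V t) (L k t) n m ≠ 0 → ε t m - ε t n = ω k t := by
    intro t ht k m n h
    have hH : rep (V t) (H t) = Matrix.diagonal fun n => (ε t n : ℂ) := by
      rw [rep, mul_assoc, hT.eigenbasis t ht, ← mul_assoc, ← Matrix.star_eq_conjTranspose,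
        Matrix.mem_unitaryGroup_iff'.1 (hT.unitary t ht), one_mul]
    have h1 := congrArg (rep (V t)) (hT.energy_change k t ht)
    rw [rep_opComm (hT.unitary t ht), rep_smul, hH] at h1
    have h2 := congrFun (congrFun h1 n) m
    rw [opComm, Matrix.sub_apply, Matrix.mul_diagonal, Matrix.diagonal_mul, Matrix.smul_apply,
      smul_eq_mul] at h2
    have h3 : ((ε t m - ε t n : ℝ) : ℂ) * rep (V t) (L k t) n m
        = (ω k t : ℂ) * rep (V t) (L k t) n m := by
      rw [← h2]; push_cast; ring
    exact_mod_cast mul_right_cancel₀ h h3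
  have h0 : ∀ t ∈ Icc 0 τ, ∀ k n, rep (V t) (L k t) n n = 0 := by
    intro t ht k n
    obtain ⟨g, hg⟩ := hjump k t ht
    by_contra h
    exact (hg n n h).1 rfl
  have hunit : ∀ t ∈ Icc 0 τ, ∀ g, IsUnit (gammaBlock (V t) (ε t) (fun k => L k t) g) := by
    intro t ht g
    refine isUnit_gammaBlock (β := β) (ω := fun k => ω k t) hT.rev_rev (fun k => ?_) (hε t ht)
      (hj t ht) (h0 t ht) (hirr t ht) g
    conv_lhs => rw [hT.detailed_balance k t ht]
    rw [rep_smul, rep_conjTranspose]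
  have hMh : ∀ t ∈ Icc 0 τ, (M t).IsHermitian := fun t ht =>
    zMatrix_isHermitian (hε t ht) (hj t ht) (h0 t ht) (hunit t ht) (hρh t ht)
  have hX₀h : ∀ t ∈ Icc 0 τ, (X₀ t).IsHermitian := fun t ht => ofRep_isHermitian _ (hMh t ht)
  have hdet : ∀ t ∈ Icc 0 τ, ((X₀ t * ∑ k, dissipator (L k t) 1).trace).re = 0 ∧
      coherenceL1 (V t) (ρ t) = -2 * ((X₀ t * ∑ k, dissipator (L k t) (ρ t)).trace).re :=
    fun t ht => detects_coherence (hT.unitary t ht) (hρh t ht) fun σ =>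
      re_trace_zMatrix_mul (hε t ht) (hj t ht) (h0 t ht) (hunit t ht) (ρ t) σ
  have hnorm : ∀ t ∈ Icc 0 τ, ∀ k, ‖opComm (L k t) (X₀ t)‖ = ‖opComm (rep (V t) (L k t)) (M t)‖ :=
    fun t ht k => norm_opComm_ofRep (hT.unitary t ht) _ _
  obtain ⟨B, hB⟩ := hT.bounded
  have hlow : ∀ t ∈ Icc 0 τ,
      1 ≤ 4 * B ^ 2 * Fintype.card ι * ∑ k, ‖opComm (L k t) (X₀ t)‖ ^ 2 := by
    intro t ht
    simp only [hnorm t ht]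
    exact one_le_sum_norm_sq_opComm (hε t ht) (hj t ht) (h0 t ht) (hunit t ht) (hρh t ht) hd
      fun k => by rw [norm_rep (hT.unitary t ht)]; exact (hB t ht).2 k
  -- Strict positivity comes from the lower bound itself, which would read 1 ≤ 0 if the constant
  -- vanished.
  have hC : 0 < 4 * B ^ 2 * Fintype.card ι := by
    refine lt_of_le_of_ne (by positivity) fun h => ?_
    have := hlow 0 ⟨le_rfl, hτ.le⟩
    rw [← h, zero_mul] at this
    linarith
  have hne : gammaR τ L U X ≠ ⊤ := gammaR_ne_top hτ hUu hXX₀ (inv_pos.2 hC) fun t ht =>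
    (inv_le_iff_one_le_mul₀' hC).2 (hlow t ht)
  refine ⟨hunit, fun t ht => ?_, hne, ?_, ?_⟩
  · rw [hXX₀ t ht]
    exact interaction_isHermitian _ (hX₀h t ht)
  · exact heat_bound hβ hτ hT hρ hUu hXX₀ hX₀h (fun t ht => (hdet t ht).1)
      (fun t ht => (hdet t ht).2) hne
  · rw [gammaR_interaction hUu hXX₀, ENNReal.mul_inv
      (Or.inl (ENNReal.inv_ne_zero.2 ENNReal.ofReal_ne_top))
      (Or.inl (ENNReal.inv_ne_top.2 (ENNReal.ofReal_pos.2 hτ).ne')), inv_inv, ← div_eq_mul_inv]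
    refine ENNReal.div_le_div_left ?_ _
    have hd1 : (1 : ℝ) ≤ d := by exact_mod_cast (by omega : 1 ≤ d)
    -- The truncated subtraction in [0, ∞] agrees with the real one because d ≥ 1.
    have hconst : (4 * (d : ℝ≥0∞) * ((d : ℝ≥0∞) - 1)) = ENNReal.ofReal (4 * d * (d - 1)) := by
      rw [ENNReal.ofReal_mul (by positivity), ENNReal.ofReal_mul (by positivity),
        ENNReal.ofReal_sub _ zero_le_one]
      simp
    have hc0 : (0 : ℝ) ≤ 4 * d * (d - 1) := mul_nonneg (by positivity) (by linarith)
    rw [hconst, ← lintegral_const_mul' _ _ ENNReal.ofReal_ne_top]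
    refine setLIntegral_mono' measurableSet_Icc fun t ht => ?_
    rw [← ENNReal.ofReal_mul hc0]
    refine ENNReal.ofReal_le_ofReal ?_
    have key := sum_norm_sq_opComm_zMatrix_le (V := V t) (ε := ε t) (L := fun k => L k t) (ρ t)
    simp only [norm_rep (hT.unitary t ht)] at key
    simp only [hnorm t ht]
    exact key

end

end Landauer

end

open Landauer in
theorem mainTheorem2 (β τ : ℝ) (hβ : 0 < β) (hτ : 0 < τ) :
    -- the qubit case
    (∀ (H V U ρ : ℝ → Op 2) (ε : ℝ → Fin 2 → ℝ) (L : Fin 2 → ℝ → Op 2) (ω : Fin 2 → ℝ → ℝ)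
        (rev : Fin 2 → Fin 2) (γ₁ γ₂ : ℝ → ℝ),
      IsThermalProtocol β τ H V ε L ω rev →
      IsLindbladPath τ H L ρ →
      IsPropagator τ H U →
      (∀ t ∈ Icc 0 τ, 0 < γ₁ t ∧ 0 < γ₂ t) →
      (∀ t ∈ Icc 0 τ, L 0 t = ((Real.sqrt (γ₁ t) : ℝ) : ℂ) • dyad (V t) 0 1) →
      (∀ t ∈ Icc 0 τ, L 1 t = ((Real.sqrt (γ₂ t) : ℝ) : ℂ) • dyad (V t) 1 0) →
      let X : ℝ → Op 2 := fun t => qubitX (γ₁ t) (γ₂ t) (V t) (U t) (ρ t)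
      (∀ t ∈ Icc 0 τ, (X t).IsHermitian) ∧
      gammaR τ L U X ≠ ⊤ ∧
      (gammaR τ L U X)⁻¹ = (ENNReal.ofReal τ)⁻¹ *
        ∫⁻ t in Icc 0 τ, ENNReal.ofReal (totalRate fun k => L k t)⁻¹ ∧
      (gammaR τ L U X)⁻¹ = (ENNReal.ofReal τ)⁻¹ *
        ∫⁻ t in Icc 0 τ, ENNReal.ofReal (γ₁ t + γ₂ t)⁻¹ ∧
      β * heat τ H ρ ≥
        entropyDrop τ ρ + (gammaR τ L U X).toReal * coherence τ V ρ ^ 2 / (2 * τ)) ∧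
    -- the generic case with non-degenerate energy levels
    (∀ (d : ℕ) (ι : Type*) [Fintype ι] (H V U ρ : ℝ → Op d) (ε : ℝ → Fin d → ℝ) (L : ι → ℝ → Op d)
        (ω : ι → ℝ → ℝ) (rev : ι → ι),
      2 ≤ d →
      IsThermalProtocol β τ H V ε L ω rev →
      IsLindbladPath τ H L ρ →
      IsPropagator τ H U →
      (∀ t ∈ Icc 0 τ, Function.Injective (ε t)) →
      (∀ k, ∀ t ∈ Icc 0 τ, IsJump (V t) (ε t) (L k t)) →
      (∀ t ∈ Icc 0 τ, IsIrreducible (V t) fun k => L k t) →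
      let X : ℝ → Op d := fun t => genericX (V t) (ε t) (fun k => L k t) (U t) (ρ t)
      (∀ t ∈ Icc 0 τ, ∀ g : ℝ, IsUnit (gammaBlock (V t) (ε t) (fun k => L k t) g)) ∧
      (∀ t ∈ Icc 0 τ, (X t).IsHermitian) ∧
      gammaR τ L U X ≠ ⊤ ∧
      β * heat τ H ρ ≥
        entropyDrop τ ρ + (gammaR τ L U X).toReal * coherence τ V ρ ^ 2 / (2 * τ) ∧
      gammaR τ L U X ≥ ENNReal.ofReal τ / (4 * (d : ℝ≥0∞) * ((d : ℝ≥0∞) - 1) *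
        ∫⁻ t in Icc 0 τ, ENNReal.ofReal ((totalRate fun k => L k t) *
          maxInvNormSq (V t) (ε t) (fun k => L k t)))) := by
  refine ⟨?_, ?_⟩
  · intro H V U ρ ε L ω rev γ₁ γ₂ hT hρ hU hγ hL₀ hL₁
    exact qubit_landauer hβ hτ hT hρ hU hγ hL₀ hL₁
  · intro d ι _ H V U ρ ε L ω rev hd hT hρ hU hε hjump hirr
    exact generic_landauer hβ hτ hd hT hρ hU hε hjump hirr
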